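/- Let $d\ge 2$. All trees are finite, nonempty rooted trees, considered up to root-preserving isomorphism; a $d$-ary tree is one in which every internal vertex has at least two and at most $d$ children, and it is strictly $d$-ary if every internal vertex has exactly $d$ children. Let $\|T\|$ be the number of leaves of $T$. A set $S$ of leaves of $T$ induces a tree: take the smallest subtree of $T$ containing $S$, root it at the most recent common ancestor of $S$, and suppress all vertices with a single child. Let $c(D,T)$ be the number of sets of $\|D\|$ leaves of $T$ that induce a tree isomorphic to $D$, let $\gamma(D,T)=c(D,T)/\binom{\|T\|}{\|D\|}$ be the density (read as $0$ if $\|T\|<\|D\|$), and let $$I_d(D)=\limsup_{n\to\infty}\ \max_{\substack{\|T\|=n\\ T\ d\text{-ary tree}}}\gamma(D,T)$$ be the $d$-ary inducibility of $D$. Define strictly $d$-ary trees $H_n^d$ recursively: $H_0^d$ is a single leaf; if $n>0$ and $n-1=ds+b$ with $0\le b<d$, then $H_n^d$ consists of a root whose branches are $d-b$ copies of $H_s^d$ and $b$ copies of $H_{s+1}^d$. For every $d$-ary tree $D$ the limit $\eta_d(D)=\lim_{n\to\infty}\gamma(D,H_n^d)$ exists, and if $I_d(D)=\eta_d(D)$,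 then $$\max_{\substack{\|T\|=(d-1)n+1\\ T\text{ strictly } d\text{-ary tree}}}\gamma(D,T)=I_d(D)+O(n^{-1})\qquad(n\to\infty),$$ where the implied constant depends only on $d$ and $D$. The condition $I_d(D)=\eta_d(D)$ holds for all even trees $D=E_k^d$, $k\ge1$. Here $E_1^d$ is a single vertex; for $2\le k\le d$, $E_k^d$ is a root with $k$ leaves as its children; and for $k=ds+b>d$ with $0\le b<d$, $E_k^d$ consists of a root whose branches are $d-b$ copies of $E_s^d$ and $b$ copies of $E_{s+1}^d$. The tree $E_k^d$ is a $d$-ary tree with $k$ leaves. -/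

import Mathlib

/-- Finite rooted trees: a single vertex (a leaf that is also the root), or a root with `k` branches
`c 0, …, c (k - 1)`. The order of the branches is irrelevant, see `FinRootedTree.Iso`. -/
inductive FinRootedTree : Type where
  | leaf : FinRootedTree
  | node (k : ℕ) (c : Fin k → FinRootedTree) : FinRootedTree

namespace FinRootedTree

/-- Isomorphism of rooted trees: the branches match up to a bijection. -/
def Iso : FinRootedTree → FinRootedTree → Prop
  | leaf, leaf => True
  | leaf, node _ _ => False
  | node _ _, leaf => False
  | node k c, node l c' => ∃ e : Fin k ≃ Fin l, ∀ i, Iso (c i) (c' (e i))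

/-- `d`-ary trees: every internal vertex has at least two and at most `d` children. -/
def IsDAry (d : ℕ) : FinRootedTree → Prop
  | leaf => True
  | node k c => 2 ≤ k ∧ k ≤ d ∧ ∀ i, IsDAry d (c i)

/-- Strictly `d`-ary trees: every internal vertex has exactly `d` children. -/
def IsStrictlyDAry (d : ℕ) : FinRootedTree → Prop
  | leaf => True
  | node k c => k = d ∧ ∀ i, IsStrictlyDAry d (c i)

/-- The type of leaves of a rooted tree. -/
def Leaf : FinRootedTree → Type
  | leaf => Unit
  | node k c => Σ i : Fin k, Leaf (c i)

/-- A tree has finitely many leaves. -/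
instance instFintypeLeaf : (T : FinRootedTree) → Fintype T.Leaf
  | leaf => inferInstanceAs (Fintype Unit)
  | node k c =>
    letI : ∀ i, Fintype (c i).Leaf := fun i => instFintypeLeaf (c i)
    inferInstanceAs (Fintype (Σ i : Fin k, (c i).Leaf))

/-- The size `‖T‖` of a tree: its number of leaves. -/
def numLeaves (T : FinRootedTree) : ℕ := Fintype.card T.Leaf

/-- The tree obtained by joining a list of trees under a common new root, where a root with only
one child is suppressed; `none` stands for the empty tree. -/
def join : List FinRootedTree → Option FinRootedTree
  | [] => none
  | [t] => some t
  | a :: b :: l => some (node (a :: b :: l).length (a :: b :: l).get)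

open Classical in
/-- The subtree of `T` induced by a set `S` of leaves: branches without a leaf in `S` are deleted,
and vertices with a single remaining child are suppressed (the root included, so that the
root of the result is the most recent common ancestor of `S`). It is `none` for empty `S`. -/
noncomputable def induced : (T : FinRootedTree) → Set T.Leaf → Option FinRootedTree
  | leaf, S => if S.Nonempty then some leaf else none
  | node k c, S =>
    join ((List.finRange k).filterMap fun i =>
      induced (c i) {x : (c i).Leaf | (⟨i, x⟩ : Σ j : Fin k, (c j).Leaf) ∈ S})

/-- The number `c(D, T)` of copies of `D` in `T`: the number of sets of `‖D‖` leaves of `T` that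
induce a tree isomorphic to `D`. -/
noncomputable def copies (D T : FinRootedTree) : ℕ :=
  Set.ncard {S : Finset T.Leaf | S.card = D.numLeaves ∧
    ∃ t : FinRootedTree, induced T (S : Set T.Leaf) = some t ∧ t.Iso D}

/-- The density `γ(D, T) = c(D, T) / binom(‖T‖, ‖D‖)`. -/
noncomputable def density (D T : FinRootedTree) : ℝ :=
  (copies D T : ℝ) / (T.numLeaves.choose D.numLeaves : ℝ)

/-- The maximum density of `D` in `d`-ary trees with `n` leaves (the supremum of a finite set of
numbers in `[0, 1]`). -/
noncomputable def maxDensity (d : ℕ) (D : FinRootedTree) (n : ℕ) : ℝ :=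
  sSup {x : ℝ | ∃ T : FinRootedTree, T.IsDAry d ∧ T.numLeaves = n ∧ x = density D T}

/-- The `d`-ary inducibility `I_d(D)`. -/
noncomputable def inducibility (d : ℕ) (D : FinRootedTree) : ℝ :=
  Filter.limsup (fun n : ℕ => maxDensity d D n) Filter.atTop

/-- The densities of `D` in the strictly `d`-ary trees with `(d - 1) n + 1` leaves. -/
def strictDensities (d : ℕ) (D : FinRootedTree) (n : ℕ) : Set ℝ :=
  {x : ℝ | ∃ T : FinRootedTree, T.IsStrictlyDAry d ∧ T.numLeaves = (d - 1) * n + 1 ∧ x = density D T}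

/-- The maximum density of `D` in strictly `d`-ary trees with `(d - 1) n + 1` leaves. -/
noncomputable def maxStrictDensity (d : ℕ) (D : FinRootedTree) (n : ℕ) : ℝ :=
  sSup (strictDensities d D n)

/-- The evenly distributed strictly `d`-ary trees `H_n^d`: `H_0^d` is a single leaf, and if
`n = d s + b` with `0 ≤ b < d`, then `H_{n+1}^d` has `d - b` branches `H_s^d` and `b` branches
`H_{s+1}^d`. -/
def strictEven (d : ℕ) : ℕ → FinRootedTree
  | 0 => leaf
  | n + 1 => node d fun i =>
      if _h : (i : ℕ) < d - n % d then strictEven d (n / d) else strictEven d (n / d + 1)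
termination_by n => n
decreasing_by
  · exact Nat.lt_succ_of_le (Nat.div_le_self n d)
  · have _hi := i.2
    have hb : 0 < n % d := by omega
    have hd : 1 < d := by
      have := Nat.mod_lt n (show 0 < d by omega)
      omega
    have hn : 0 < n := by
      rcases Nat.eq_zero_or_pos n with h0 | h0
      · simp [h0] at hb
      · exact h0
    have := Nat.div_lt_self hn hd
    omega

/-- The limit `η_d(D)` of `γ(D, H_n^d)` as `n → ∞`. -/
noncomputable def eta (d : ℕ) (D : FinRootedTree) : ℝ :=
  Filter.limUnder Filter.atTop fun n : ℕ => density D (strictEven d n)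

/-- The even `d`-ary tree `E_k^d` with `k` leaves, for `d ≥ 2` and `k ≥ 1`: a single vertex for
`k = 1`, a root with `k` leaves as its children for `2 ≤ k ≤ d`, and for `k = d s + b > d` with
`0 ≤ b < d` the tree with `d - b` branches `E_s^d` and `b` branches `E_{s+1}^d`. -/
def even (d k : ℕ) : FinRootedTree :=
  if _h : d ≤ 1 ∨ k ≤ 1 then leaf
  else if _hk : k ≤ d then node k fun _ => leaf
  else node d fun i => if (i : ℕ) < d - k % d then even d (k / d) else even d (k / d + 1)
termination_by k
decreasing_by
  · exact Nat.div_lt_self (by omega) (by omega)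
  · have : k / d ≤ k / 2 := Nat.div_le_div_left (by omega) (by omega)
    omega

end FinRootedTree

/-! Write m = ‖D‖ and N = ‖T‖. Everything rests on one recursion (`copies_node_node`): a copy of D
in T either lies in a single branch of T, or places the branches of D in distinct branches of T. The
second kind is counted by a sum over injections of products of branch counts, in which each copy
appears once for every symmetry of the branches of D.

Upper bound: blowing up every leaf of T into a tree S multiplies the count by at least ‖S‖^m, whence
c(D,T) m! / N^m ≤ I_d(D) for every single d-ary T (`copies_mul_factorial_div_pow_le_inducibility`).
As N^m / m! is the binomial coefficient up to a factor 1 + O(1/N), no tree has density above I_d(D)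
(1 + O(1/N)). Lower bound: the branches of H_n^d have N/d + O(1) leaves, so the recursion gives c(D,
H_n^d) = a N^m + O(N^(m-1)) by induction on D (`hasLeadingCoeff_node`). Thus γ(D, H_n^d) = η_d(D) +
O(1/n), and if I_d(D) = η_d(D) the maximum is squeezed between the two.

For even trees the same constant a satisfies c(D,T) ≤ a N^m for all d-ary T (`copies_node_le`). By
the recursion this reduces to a Muirhead-type inequality (`mul_sum_embedding_le`): (∑ x_i)^m - ∑
x_i^m is a sum of d^m - d monomials, and among symmetrized monomials of degree m those with nearly
equal exponents are smallest. The branches of an even tree have nearly equal sizes, so this applies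
at every level. -/

namespace FinRootedTree

/-! ### Isomorphism and number of leaves -/

theorem Iso.refl : ∀ T : FinRootedTree, T.Iso T
  | leaf => by simp [Iso]
  | node k c => by
    simp only [Iso]
    exact ⟨Equiv.refl _, fun i => Iso.refl (c i)⟩

theorem Iso.symm : ∀ {T U : FinRootedTree}, T.Iso U → U.Iso T
  | leaf, leaf, _ => by simp [Iso]
  | leaf, node _ _, h => by simp [Iso] at h
  | node _ _, leaf, h => by simp [Iso] at h
  | node k c, node l c', h => by
    simp only [Iso] at h ⊢
    obtain ⟨e, he⟩ := h
    exact ⟨e.symm, fun i => by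
      have := Iso.symm (he (e.symm i))
      simpa using this⟩

theorem Iso.trans : ∀ {T U V : FinRootedTree}, T.Iso U → U.Iso V → T.Iso V
  | leaf, leaf, leaf, _, _ => by simp [Iso]
  | leaf, leaf, node _ _, _, h => by simp [Iso] at h
  | leaf, node _ _, _, h, _ => by simp [Iso] at h
  | node _ _, leaf, _, h, _ => by simp [Iso] at h
  | node _ _, node _ _, leaf, _, h => by simp [Iso] at h
  | node k c, node l c', node m c'', h, h' => by
    simp only [Iso] at h h' ⊢
    obtain ⟨e, he⟩ := h
    obtain ⟨f, hf⟩ := h'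
    exact ⟨e.trans f, fun i => Iso.trans (he i) (hf (e i))⟩

@[simp] theorem numLeaves_leaf : leaf.numLeaves = 1 := rfl

theorem numLeaves_node (k : ℕ) (c : Fin k → FinRootedTree) :
    (node k c).numLeaves = ∑ i, (c i).numLeaves := by
  have : Fintype.card (Σ i, (c i).Leaf) = ∑ i, (c i).numLeaves := Fintype.card_sigma
  rw [← this]
  exact Fintype.card_congr (Equiv.refl _)

theorem Iso.numLeaves_eq : ∀ {T U : FinRootedTree}, T.Iso U → T.numLeaves = U.numLeaves
  | leaf, leaf, _ => rfl
  | leaf, node _ _, h => by simp [Iso] at h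
  | node _ _, leaf, h => by simp [Iso] at h
  | node k c, node l c', h => by
    simp only [Iso] at h
    obtain ⟨e, he⟩ := h
    rw [numLeaves_node, numLeaves_node, ← e.sum_comp]
    exact Finset.sum_congr rfl fun i _ => Iso.numLeaves_eq (he i)

/-! ### Induced trees, branch by branch -/

/-- The part of a set of leaves that lies in the `i`-th branch. -/
def slice {k : ℕ} {c : Fin k → FinRootedTree} (S : Set (node k c).Leaf) (i : Fin k) :
    Set (c i).Leaf :=
  {x | (⟨i, x⟩ : Σ j : Fin k, (c j).Leaf) ∈ S}

theorem slice_ext {k : ℕ} {c : Fin k → FinRootedTree} {S S' : Set (node k c).Leaf}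
    (h : ∀ i, slice S i = slice S' i) : S = S' := by
  ext ⟨i, x⟩
  exact Set.ext_iff.1 (h i) x

theorem eq_empty_iff_slice {k : ℕ} {c : Fin k → FinRootedTree} {S : Set (node k c).Leaf} :
    S = ∅ ↔ ∀ i, slice S i = ∅ := by
  constructor
  · rintro rfl i
    rfl
  · intro h
    exact slice_ext fun i => by rw [h i]; rfl

theorem induced_leaf_of_nonempty {S : Set leaf.Leaf} (h : S.Nonempty) :
    induced leaf S = some leaf := by
  simp [induced, h]

theorem induced_node (k : ℕ) (c : Fin k → FinRootedTree) (S : Set (node k c).Leaf) :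
    induced (node k c) S =
      join ((List.finRange k).filterMap fun i => induced (c i) (slice S i)) := by
  rw [induced]; rfl

theorem join_eq_none {l : List FinRootedTree} : join l = none ↔ l = [] := by
  match l with
  | [] => simp [join]
  | [_] => simp [join]
  | _ :: _ :: _ => simp [join]

theorem join_of_two_le {l : List FinRootedTree} (h : 2 ≤ l.length) :
    join l = some (node l.length l.get) := by
  match l, h with
  | _ :: _ :: _, _ => simp [join]

theorem induced_eq_none_iff : ∀ (T : FinRootedTree) (S : Set T.Leaf), induced T S = none ↔ S = ∅
  | leaf, S => by
    by_cases h : S.Nonempty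
    · simp [induced, h, h.ne_empty]
    · simp [induced, Set.not_nonempty_iff_eq_empty.1 h]
  | node k c, S => by
    rw [induced_node, join_eq_none, List.filterMap_eq_nil_iff, eq_empty_iff_slice]
    exact ⟨fun h i => (induced_eq_none_iff (c i) _).1 (h i (List.mem_finRange i)),
      fun h i _ => (induced_eq_none_iff (c i) _).2 (h i)⟩

/-- Recovers, from the list that `filterMap` produces, an injection telling where each entry came
from; afterwards only functions on `Fin` are needed. -/
theorem exists_index_of_filterMap {α β : Type*} (g : β → Option α) (l : List β) (hl : l.Nodup) :
    ∃ f : Fin (l.filterMap g).length → β, Function.Injective f ∧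
      (∀ i, f i ∈ l) ∧ (∀ i, g (f i) = some ((l.filterMap g).get i)) ∧
      ∀ b ∈ l, g b ≠ none → ∃ i, f i = b := by
  induction l with
  | nil => exact ⟨fun i => i.elim0, fun i => i.elim0, fun i => i.elim0, fun i => i.elim0, by simp⟩
  | cons a l ih =>
    obtain ⟨f, hf, hfl, hfg, hfs⟩ := ih hl.of_cons
    have ha : a ∉ l := (List.nodup_cons.1 hl).1
    cases hga : g a with
    | none =>
      rw [List.filterMap_cons_none hga]
      refine ⟨f, hf, fun i => List.mem_cons_of_mem _ (hfl i), hfg, fun b hb hgb => ?_⟩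
      rcases List.mem_cons.1 hb with rfl | hb
      · exact absurd hga hgb
      · exact hfs b hb hgb
    | some t =>
      rw [List.filterMap_cons_some hga]
      refine ⟨Fin.cons a f, ?_, ?_, ?_, ?_⟩
      · rw [Fin.cons_injective_iff]
        exact ⟨fun ⟨i, hi⟩ => ha (hi ▸ hfl i), hf⟩
      · intro i
        refine Fin.cases ?_ (fun i => ?_) i
        · simp
        · exact List.mem_cons_of_mem _ (hfl i)
      · intro i
        refine Fin.cases ?_ (fun i => ?_) i
        · simpa using hga
        · simpa using hfg i
      · intro b hb hgb
        rcases List.mem_cons.1 hb with rfl | hb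
        · exact ⟨0, rfl⟩
        · obtain ⟨i, hi⟩ := hfs b hb hgb
          exact ⟨i.succ, by simpa using hi⟩

/-- The tree induced by a nonempty set of leaves: either all leaves lie in one branch, or the
branches that are met become the branches of the induced tree. -/
theorem induced_node_cases {k : ℕ} {c : Fin k → FinRootedTree} {S : Set (node k c).Leaf}
    {t : FinRootedTree} (h : induced (node k c) S = some t) :
    (∃ i, (∀ j, j ≠ i → slice S j = ∅) ∧ induced (c i) (slice S i) = some t) ∨
    ∃ (r : ℕ) (u : Fin r → FinRootedTree) (f : Fin r → Fin k), 2 ≤ r ∧ t = node r u ∧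
      Function.Injective f ∧ (∀ j, induced (c (f j)) (slice S (f j)) = some (u j)) ∧
      ∀ i, i ∉ Set.range f → slice S i = ∅ := by
  obtain ⟨f, hf, -, hfg, hfs⟩ := exists_index_of_filterMap
    (fun i => induced (c i) (slice S i)) (List.finRange k) (List.nodup_finRange k)
  rw [induced_node] at h
  generalize (List.finRange k).filterMap (fun i => induced (c i) (slice S i)) = L at *
  have hout : ∀ i, i ∉ Set.range f → slice S i = ∅ := by
    intro i hi
    by_contra hne
    refine hi (hfs i (List.mem_finRange i) fun h0 => hne ?_)
    exact (induced_eq_none_iff _ _).1 h0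
  rcases Nat.lt_or_ge L.length 2 with hL | hL
  · left
    match L, h, f, hf, hfg, hout with
    | [], h, _, _, _, _ => simp [join] at h
    | [s], h, f, hf, hfg, hout =>
      simp only [join, Option.some.injEq] at h
      subst h
      refine ⟨f 0, fun j hj => hout j ?_, by simpa using hfg 0⟩
      rintro ⟨i, rfl⟩
      exact hj (congrArg f (Subsingleton.elim (α := Fin 1) i 0))
  · right
    rw [join_of_two_le hL, Option.some.injEq] at h
    exact ⟨L.length, L.get, f, hL, h.symm, hf, hfg, hout⟩

theorem induced_node_of_single {k : ℕ} {c : Fin k → FinRootedTree} {S : Set (node k c).Leaf}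
    {t : FinRootedTree} {i : Fin k} (h : ∀ j, j ≠ i → slice S j = ∅)
    (ht : induced (c i) (slice S i) = some t) : induced (node k c) S = some t := by
  cases h' : induced (node k c) S with
  | none =>
    rw [induced_eq_none_iff, eq_empty_iff_slice] at h'
    rw [(induced_eq_none_iff _ _).2 (h' i)] at ht
    exact absurd ht (by simp)
  | some u =>
    rcases induced_node_cases h' with ⟨i', hi', hu⟩ | ⟨r, v, f, hr, rfl, hf, hfv, -⟩
    · have : i = i' := by
        by_contra hne
        rw [(induced_eq_none_iff _ _).2 (hi' i hne)] at ht
        exact absurd ht (by simp)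
      subst this
      rw [← hu, ht]
    · exfalso
      have key : ∀ j, f j = i := fun j => by
        by_contra hne
        have := hfv j
        rw [(induced_eq_none_iff _ _).2 (h _ hne)] at this
        exact absurd this (by simp)
      have := hf ((key ⟨0, by omega⟩).trans (key ⟨1, by omega⟩).symm)
      simp at this

theorem slice_nonempty_of_induced {T : FinRootedTree} {S : Set T.Leaf} {t : FinRootedTree}
    (h : induced T S = some t) : S.Nonempty := by
  rw [Set.nonempty_iff_ne_empty]
  intro h0
  rw [(induced_eq_none_iff _ _).2 h0] at h
  exact absurd h (by simp)

/-- `S` induces a tree isomorphic to `D` in `T`. -/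
def Induces (T : FinRootedTree) (S : Set T.Leaf) (D : FinRootedTree) : Prop :=
  ∃ t : FinRootedTree, induced T S = some t ∧ t.Iso D

theorem Induces.nonempty {T D : FinRootedTree} {S : Set T.Leaf} (h : Induces T S D) :
    S.Nonempty :=
  slice_nonempty_of_induced h.choose_spec.1

theorem Induces.congr {T D E : FinRootedTree} {S : Set T.Leaf} (h : Induces T S D)
    (hDE : D.Iso E) : Induces T S E :=
  ⟨h.choose, h.choose_spec.1, h.choose_spec.2.trans hDE⟩

theorem Induces.iso {T D E : FinRootedTree} {S : Set T.Leaf} (h : Induces T S D)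
    (h' : Induces T S E) : D.Iso E := by
  obtain ⟨t, ht, htD⟩ := h
  obtain ⟨u, hu, huE⟩ := h'
  rw [ht, Option.some.injEq] at hu
  subst hu
  exact htD.symm.trans huE

theorem induces_node_leaf {k : ℕ} {c : Fin k → FinRootedTree} {S : Set (node k c).Leaf} :
    Induces (node k c) S leaf ↔
      ∃ i, (∀ j, j ≠ i → slice S j = ∅) ∧ Induces (c i) (slice S i) leaf := by
  constructor
  · rintro ⟨t, ht, hD⟩
    rcases induced_node_cases ht with ⟨i, hi, hu⟩ | ⟨r, v, f, hr, rfl, hf, hfv, -⟩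
    · exact ⟨i, hi, t, hu, hD⟩
    · simp [Iso] at hD
  · rintro ⟨i, hi, t, ht, hD⟩
    exact ⟨t, induced_node_of_single hi ht, hD⟩

/-- `S` induces the tree with branches `D j` in such a way that branch `D j` is induced in the
branch `c (σ j)`. -/
def InducesAlong {k r : ℕ} {c : Fin k → FinRootedTree} (D : Fin r → FinRootedTree)
    (σ : Fin r ↪ Fin k) (S : Set (node k c).Leaf) : Prop :=
  (∀ j, Induces (c (σ j)) (slice S (σ j)) (D j)) ∧ ∀ i, i ∉ Set.range σ → slice S i = ∅

theorem induces_node_node {k r : ℕ} {c : Fin k → FinRootedTree} {D : Fin r → FinRootedTree}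
    (hr : 2 ≤ r) {S : Set (node k c).Leaf} :
    Induces (node k c) S (node r D) ↔
      (∃ i, (∀ j, j ≠ i → slice S j = ∅) ∧ Induces (c i) (slice S i) (node r D)) ∨
      ∃ σ : Fin r ↪ Fin k, InducesAlong D σ S := by
  constructor
  · rintro ⟨t, ht, hD⟩
    rcases induced_node_cases ht with ⟨i, hi, hu⟩ | ⟨l, v, f, -, rfl, hf, hfv, hout⟩
    · exact Or.inl ⟨i, hi, t, hu, hD⟩
    · right
      simp only [Iso] at hD
      obtain ⟨e, he⟩ := hD
      refine ⟨⟨fun j => f (e.symm j), hf.comp e.symm.injective⟩, fun j => ?_, fun i hi => ?_⟩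
      · exact ⟨_, hfv _, by simpa using he (e.symm j)⟩
      · refine hout i ?_
        rintro ⟨j, rfl⟩
        exact hi ⟨e j, by simp⟩
  · rintro (⟨i, hi, t, ht, hD⟩ | ⟨σ, hσ, hout⟩)
    · exact ⟨t, induced_node_of_single hi ht, hD⟩
    · have hne : ∀ j, (slice S (σ j)).Nonempty := fun j => (hσ j).nonempty
      cases h' : induced (node k c) S with
      | none =>
        rw [induced_eq_none_iff, eq_empty_iff_slice] at h'
        exact absurd (h' _) (hne ⟨0, by omega⟩).ne_empty
      | some t =>
        refine ⟨t, h', ?_⟩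
        rcases induced_node_cases h' with ⟨i, hi, hu⟩ | ⟨l, v, f, -, rfl, hf, hfv, hout'⟩
        · have key : ∀ j, σ j = i := fun j => by
            by_contra hn
            exact (hne j).ne_empty (hi _ hn)
          have := σ.injective ((key ⟨0, by omega⟩).trans (key ⟨1, by omega⟩).symm)
          simp at this
        · simp only [Iso]
          -- Both `σ` and `f` enumerate precisely the branches that `S` meets; comparing them yields
          -- the bijection of branches.
          have h1 : ∀ j, f j ∈ Set.range σ := fun j => by
            by_contra hn
            exact (slice_nonempty_of_induced (hfv j)).ne_empty (hout _ hn)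
          have h2 : ∀ j, σ j ∈ Set.range f := fun j => by
            by_contra hn
            exact (hne j).ne_empty (hout' _ hn)
          choose g hg using h1
          choose g' hg' using h2
          refine ⟨⟨g, g', fun j => hf ?_, fun j => σ.injective ?_⟩, fun j => ?_⟩
          · rw [hg', hg]
          · rw [hg, hg']
          · obtain ⟨t, ht, htD⟩ := hσ (g j)
            rw [hg, hfv, Option.some.injEq] at ht
            subst ht
            exact htD

theorem card_eq_sum_slice {k : ℕ} {c : Fin k → FinRootedTree} (S : Set (node k c).Leaf) :
    Nat.card S = ∑ i, Nat.card (slice S i) := by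
  rw [← Nat.card_sigma]
  exact Nat.card_congr
    { toFun := fun x => ⟨x.1.1, ⟨x.1.2, x.2⟩⟩
      invFun := fun y => ⟨⟨y.1, y.2.1⟩, y.2.2⟩
      left_inv := fun _ => rfl
      right_inv := fun _ => rfl }

theorem numLeaves_of_induced : ∀ (T : FinRootedTree) (S : Set T.Leaf) (t : FinRootedTree),
    induced T S = some t → t.numLeaves = Nat.card S
  | leaf, S, t, h => by
    have hS := slice_nonempty_of_induced h
    rw [induced_leaf_of_nonempty hS, Option.some.injEq] at h
    subst h
    obtain ⟨x, hx⟩ := hS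
    have : Subsingleton leaf.Leaf := inferInstanceAs (Subsingleton Unit)
    have : Unique S := ⟨⟨⟨x, hx⟩⟩, fun _ => Subsingleton.elim _ _⟩
    simp
  | node k c, S, t, h => by
    rw [card_eq_sum_slice]
    rcases induced_node_cases h with ⟨i, hi, hu⟩ | ⟨l, v, f, -, rfl, hf, hfv, hout⟩
    · rw [numLeaves_of_induced (c i) _ _ hu, Finset.sum_eq_single i]
      · intro j _ hj
        simp [hi j hj]
      · simp
    · rw [numLeaves_node]
      refine Eq.trans (Finset.sum_congr rfl fun j _ => numLeaves_of_induced _ _ _ (hfv j)) ?_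
      rw [← Finset.sum_subset (Finset.subset_univ (Finset.univ.map ⟨f, hf⟩)), Finset.sum_map]
      · rfl
      · intro i _ hi
        rw [hout i (by simpa using hi)]
        simp

/-! ### Counting copies: the recursion -/

/-- The cardinality condition is redundant, since by `numLeaves_of_induced` an induced tree has as
many leaves as the set inducing it. -/
theorem copies_eq_card (D T : FinRootedTree) :
    copies D T = Nat.card {S : Set T.Leaf // Induces T S D} := by
  classical
  rw [copies, ← Nat.card_coe_set_eq]
  refine Nat.card_congr
    { toFun := fun S => ⟨(S.1 : Set T.Leaf), S.2.2⟩
      invFun := fun S => ⟨S.1.toFinset, ?_, ?_⟩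
      left_inv := fun S => by simp
      right_inv := fun S => by simp }
  · obtain ⟨t, ht, htD⟩ := S.2
    rw [← htD.numLeaves_eq, numLeaves_of_induced _ _ _ ht, Nat.card_eq_fintype_card,
      Set.toFinset_card]
  · rw [Set.coe_toFinset]
    exact S.2

theorem copies_le_choose (D T : FinRootedTree) :
    copies D T ≤ T.numLeaves.choose D.numLeaves := by
  classical
  have : T.numLeaves.choose D.numLeaves =
      (Finset.powersetCard D.numLeaves (Finset.univ : Finset T.Leaf)).card := by
    rw [Finset.card_powersetCard]; rfl
  rw [this, copies, ← Set.ncard_coe_finset]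
  refine Set.ncard_le_ncard (fun S hS => ?_) (Finset.finite_toSet _)
  simpa [Finset.mem_powersetCard] using hS.1

/-- Leaf sets in a single branch. -/
theorem card_single_branch {k : ℕ} (c : Fin k → FinRootedTree) (D : FinRootedTree) :
    Nat.card {S : Set (node k c).Leaf //
      ∃ i, (∀ j, j ≠ i → slice S j = ∅) ∧ Induces (c i) (slice S i) D} =
      ∑ i, copies D (c i) := by
  classical
  simp_rw [copies_eq_card]
  rw [← Nat.card_sigma]
  have hs : ∀ (i : Fin k) (S : Set (c i).Leaf),
      slice (c := c) ((fun x => (⟨i, x⟩ : Σ j, (c j).Leaf)) '' S) i = S := fun i S => by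
    ext x
    constructor
    · rintro ⟨y, hy, hyx⟩
      obtain rfl : y = x := eq_of_heq (Sigma.mk.inj hyx).2
      exact hy
    · intro hx
      exact ⟨x, hx, rfl⟩
  have hs' : ∀ (i : Fin k) (S : Set (c i).Leaf) (j : Fin k), j ≠ i →
      slice (c := c) ((fun x => (⟨i, x⟩ : Σ j, (c j).Leaf)) '' S) j = ∅ := fun i S j hj => by
    ext x
    constructor
    · rintro ⟨y, hy, hyx⟩
      exact absurd (congrArg Sigma.fst hyx).symm hj
    · rintro ⟨⟩
  symm
  refine Nat.card_congr (Equiv.ofBijective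
    (fun p => ⟨(fun x => (⟨p.1, x⟩ : Σ j, (c j).Leaf)) '' p.2.1, p.1, hs' _ _, ?_⟩) ⟨?_, ?_⟩)
  · rw [hs]
    exact p.2.2
  · rintro ⟨i, S, hS⟩ ⟨i', S', hS'⟩ h
    have h := congrArg Subtype.val h
    dsimp only at h
    have hi : i = i' := by
      by_contra hne
      have h1 := hs i S
      rw [h, hs' i' S' i hne] at h1
      exact hS.nonempty.ne_empty h1.symm
    subst hi
    have : S = S' := by rw [← hs i S, h, hs]
    subst this
    rfl
  · rintro ⟨S, i, hi, hS⟩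
    refine ⟨⟨i, slice S i, hS⟩, Subtype.ext (slice_ext fun j => ?_)⟩
    by_cases hj : j = i
    · subst hj
      exact hs _ _
    · rw [hi j hj]
      exact hs' i _ j hj

/-- For fixed `σ` the set is determined by its slices in the branches `σ j`, and these can be chosen
independently. -/
theorem card_inducesAlong {k r : ℕ} (c : Fin k → FinRootedTree) (D : Fin r → FinRootedTree)
    (σ : Fin r ↪ Fin k) :
    Nat.card {S : Set (node k c).Leaf // InducesAlong D σ S} = ∏ j, copies (D j) (c (σ j)) := by
  classical
  simp_rw [copies_eq_card]
  rw [← Nat.card_pi]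
  refine Nat.card_congr (Equiv.ofBijective (fun S j => ⟨slice S.1 (σ j), S.2.1 j⟩) ⟨?_, ?_⟩)
  · rintro ⟨S, hS⟩ ⟨S', hS'⟩ h
    refine Subtype.ext (slice_ext fun i => ?_)
    by_cases hi : i ∈ Set.range σ
    · obtain ⟨j, rfl⟩ := hi
      exact congrArg Subtype.val (congrFun h j)
    · rw [hS.2 i hi, hS'.2 i hi]
  · intro f
    let S : Set (node k c).Leaf :=
      {p : Σ i, (c i).Leaf | ∃ j, ∃ y ∈ (f j).1, p = ⟨σ j, y⟩}
    have h1 : ∀ j, slice S (σ j) = (f j).1 := fun j => by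
      ext x
      constructor
      · rintro ⟨j', y, hy, hp⟩
        have : j = j' := σ.injective (congrArg Sigma.fst hp)
        subst this
        obtain rfl : x = y := by simpa using hp
        exact hy
      · intro hx
        exact ⟨j, x, hx, rfl⟩
    refine ⟨⟨S, fun j => ?_, fun i hi => ?_⟩, ?_⟩
    · rw [h1]
      exact (f j).2
    · ext x
      constructor
      · rintro ⟨j', y, hy, hp⟩
        exact hi ⟨j', (congrArg Sigma.fst hp).symm⟩
      · rintro ⟨⟩
    · funext j
      exact Subtype.ext (h1 j)

/-- The number of permutations of the branches that respect isomorphism classes. -/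
noncomputable def branchSymm {r : ℕ} (D : Fin r → FinRootedTree) : ℕ :=
  Nat.card {π : Equiv.Perm (Fin r) // ∀ j, (D (π j)).Iso (D j)}

theorem branchSymm_pos {r : ℕ} (D : Fin r → FinRootedTree) : 0 < branchSymm D := by
  have : Nonempty {π : Equiv.Perm (Fin r) // ∀ j, (D (π j)).Iso (D j)} :=
    ⟨⟨1, fun j => Iso.refl _⟩⟩
  exact Nat.card_pos

/-- Two embeddings belonging to the same set have the same range, namely the branches it meets, so
they differ by a permutation of `Fin r`. That permutation respects isomorphism classes because a
slice induces only one tree up to isomorphism. -/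
theorem card_embedding_of_inducesAlong {k r : ℕ} {c : Fin k → FinRootedTree}
    {D : Fin r → FinRootedTree} {σ : Fin r ↪ Fin k} {S : Set (node k c).Leaf}
    (h : InducesAlong D σ S) :
    Nat.card {τ : Fin r ↪ Fin k // InducesAlong D τ S} = branchSymm D := by
  symm
  refine Nat.card_congr (Equiv.ofBijective
    (fun π => ⟨π.1.toEmbedding.trans σ, fun j => ?_, fun i hi => ?_⟩) ⟨?_, ?_⟩)
  · exact (h.1 (π.1 j)).congr (π.2 j)
  · refine h.2 i ?_
    rintro ⟨j, rfl⟩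
    exact hi ⟨π.1.symm j, by simp⟩
  · rintro ⟨π, hπ⟩ ⟨π', hπ'⟩ hh
    refine Subtype.ext (Equiv.ext fun j => σ.injective ?_)
    exact DFunLike.congr_fun (congrArg Subtype.val hh) j
  · rintro ⟨τ, hτ⟩
    have h1 : ∀ j, τ j ∈ Set.range σ := fun j => by
      by_contra hn
      exact (hτ.1 j).nonempty.ne_empty (h.2 _ hn)
    choose g hg using h1
    have hinj : Function.Injective g := fun a b hab => τ.injective (by rw [← hg, hab, hg])
    refine ⟨⟨Equiv.ofBijective g (Finite.injective_iff_bijective.1 hinj), fun j => ?_⟩, ?_⟩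
    · have := h.1 (g j)
      rw [hg] at this
      exact this.iso (hτ.1 j)
    · refine Subtype.ext (Function.Embedding.ext fun j => ?_)
      exact hg j

theorem copies_leaf_leaf : copies leaf leaf = 1 := by
  rw [copies_eq_card]
  have : Unique {S : Set leaf.Leaf // Induces leaf S leaf} :=
    { default := ⟨Set.univ, leaf, induced_leaf_of_nonempty ⟨(), trivial⟩, by simp [Iso]⟩
      uniq := fun S => Subtype.ext (by
        obtain ⟨x, hx⟩ := S.2.nonempty
        ext y
        have : Subsingleton leaf.Leaf := inferInstanceAs (Subsingleton Unit)
        rw [Subsingleton.elim y x]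
        exact ⟨fun _ => trivial, fun _ => hx⟩) }
  exact Nat.card_unique

theorem copies_node_leaf (r : ℕ) (D : Fin r → FinRootedTree) : copies (node r D) leaf = 0 := by
  rw [copies_eq_card]
  have : IsEmpty {S : Set leaf.Leaf // Induces leaf S (node r D)} := ⟨fun S => by
    obtain ⟨t, ht, hD⟩ := S.2
    rw [induced_leaf_of_nonempty S.2.nonempty, Option.some.injEq] at ht
    subst ht
    simp [Iso] at hD⟩
  exact Nat.card_of_isEmpty

theorem copies_leaf : ∀ T : FinRootedTree, copies leaf T = T.numLeaves
  | leaf => copies_leaf_leaf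
  | node k c => by
    rw [copies_eq_card, numLeaves_node]
    simp_rw [induces_node_leaf]
    rw [card_single_branch]
    exact Finset.sum_congr rfl fun i _ => copies_leaf (c i)

/-- The recursion for the number of copies. -/
theorem copies_node_node {k r : ℕ} (hr : 2 ≤ r) (c : Fin k → FinRootedTree)
    (D : Fin r → FinRootedTree) :
    branchSymm D * copies (node r D) (node k c) =
      branchSymm D * ∑ i, copies (node r D) (c i) +
        ∑ σ : Fin r ↪ Fin k, ∏ j, copies (D j) (c (σ j)) := by
  classical
  have hsplit : copies (node r D) (node k c) = ∑ i, copies (node r D) (c i) +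
      Nat.card {S : Set (node k c).Leaf // ∃ σ : Fin r ↪ Fin k, InducesAlong D σ S} := by
    rw [copies_eq_card, ← card_single_branch]
    simp_rw [induces_node_node hr]
    rw [← Nat.card_sum]
    refine Nat.card_congr (subtypeOrEquiv _ _ ?_)
    rw [Pi.disjoint_iff]
    intro S
    rw [disjoint_iff_inf_le]
    rintro ⟨⟨i, hi, -⟩, σ, hσ⟩
    have key : ∀ j, σ j = i := fun j => by
      by_contra hn
      exact (hσ.1 j).nonempty.ne_empty (hi _ hn)
    have := σ.injective ((key ⟨0, by omega⟩).trans (key ⟨1, by omega⟩).symm)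
    simp at this
  -- Double counting of the pairs (σ, S) with S inducing the branches along σ.
  have hdouble : branchSymm D *
      Nat.card {S : Set (node k c).Leaf // ∃ σ : Fin r ↪ Fin k, InducesAlong D σ S} =
      ∑ σ : Fin r ↪ Fin k, ∏ j, copies (D j) (c (σ j)) := by
    simp_rw [← card_inducesAlong]
    rw [← Nat.card_sigma]
    have e : (Σ σ : Fin r ↪ Fin k, {S : Set (node k c).Leaf // InducesAlong D σ S}) ≃
        Σ S : {S : Set (node k c).Leaf // ∃ σ : Fin r ↪ Fin k, InducesAlong D σ S},
          {τ : Fin r ↪ Fin k // InducesAlong D τ S.1} :=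
      { toFun := fun p => ⟨⟨p.2.1, p.1, p.2.2⟩, ⟨p.1, p.2.2⟩⟩
        invFun := fun q => ⟨q.2.1, ⟨q.1.1, q.2.2⟩⟩
        left_inv := fun _ => rfl
        right_inv := fun _ => rfl }
    rw [Nat.card_congr e, Nat.card_sigma,
      Finset.sum_congr rfl fun S _ => card_embedding_of_inducesAlong S.2.choose_spec]
    simp [mul_comm]
  rw [hsplit, mul_add, hdouble]

theorem IsDAry.numLeaves_pos {d : ℕ} : ∀ {T : FinRootedTree}, T.IsDAry d → 0 < T.numLeaves
  | leaf, _ => Nat.one_pos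
  | node k c, h => by
    simp only [IsDAry] at h
    rw [numLeaves_node]
    exact Finset.sum_pos (fun i _ => (h.2.2 i).numLeaves_pos) ⟨⟨0, by omega⟩, Finset.mem_univ _⟩

/-! ### Blowing up leaves; lower bounds for the inducibility -/

/-- Replace every leaf of a tree by a copy of `S`. -/
def graft (S : FinRootedTree) : FinRootedTree → FinRootedTree
  | leaf => S
  | node k c => node k fun i => graft S (c i)

theorem numLeaves_graft (S : FinRootedTree) :
    ∀ T : FinRootedTree, (graft S T).numLeaves = T.numLeaves * S.numLeaves
  | leaf => by simp [graft]
  | node k c => by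
    rw [graft, numLeaves_node, numLeaves_node, Finset.sum_mul]
    exact Finset.sum_congr rfl fun i _ => numLeaves_graft S (c i)

theorem IsDAry.graft {d : ℕ} {S : FinRootedTree} (hS : S.IsDAry d) :
    ∀ {T : FinRootedTree}, T.IsDAry d → (graft S T).IsDAry d
  | leaf, _ => hS
  | node k c, h => by
    simp only [IsDAry, FinRootedTree.graft] at h ⊢
    exact ⟨h.1, h.2.1, fun i => IsDAry.graft hS (h.2.2 i)⟩

/-- Given a copy of `D` in `T`, picking one leaf from each of the copies of `S` that replace its
leaves gives a copy in the graft. Instead of building this injection, the recursions for both trees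
are compared term by term. -/
theorem copies_mul_pow_le_copies_graft {d : ℕ} (S : FinRootedTree) :
    ∀ {D : FinRootedTree}, D.IsDAry d → ∀ T : FinRootedTree,
      copies D T * S.numLeaves ^ D.numLeaves ≤ copies D (FinRootedTree.graft S T)
  | leaf, _, T => by simp [copies_leaf, numLeaves_graft]
  | node r D, hD, leaf => by simp [copies_node_leaf]
  | node r D, hD, node k c => by
    have h := hD
    simp only [IsDAry] at h
    refine Nat.le_of_mul_le_mul_left (c := branchSymm D) ?_ (branchSymm_pos D)
    rw [FinRootedTree.graft, copies_node_node h.1, ← mul_assoc, copies_node_node h.1, add_mul]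
    refine Nat.add_le_add ?_ ?_
    · rw [mul_assoc, Finset.sum_mul]
      exact Nat.mul_le_mul_left _
        (Finset.sum_le_sum fun i _ => copies_mul_pow_le_copies_graft S hD (c i))
    · rw [Finset.sum_mul]
      refine Finset.sum_le_sum fun σ _ => ?_
      rw [numLeaves_node, ← Finset.prod_pow_eq_pow_sum, ← Finset.prod_mul_distrib]
      exact Finset.prod_le_prod' fun j _ => copies_mul_pow_le_copies_graft S (h.2.2 j) (c (σ j))

theorem exists_isDAry_numLeaves {d : ℕ} (hd : 2 ≤ d) (n : ℕ) :
    ∃ T : FinRootedTree, T.IsDAry d ∧ T.numLeaves = n + 1 := by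
  induction n with
  | zero => exact ⟨leaf, by simp [IsDAry], rfl⟩
  | succ n ih =>
    obtain ⟨T, hT, hn⟩ := ih
    refine ⟨node 2 ![T, leaf], ?_, ?_⟩
    · simp [IsDAry, hd, Fin.forall_fin_two, hT]
    · simp [numLeaves_node, hn]

theorem density_nonneg (D T : FinRootedTree) : 0 ≤ density D T := by
  unfold density; positivity

theorem density_le_one (D T : FinRootedTree) : density D T ≤ 1 := by
  unfold density
  exact div_le_one_of_le₀ (by exact_mod_cast copies_le_choose D T) (by positivity)

theorem maxDensity_nonneg (d : ℕ) (D : FinRootedTree) (n : ℕ) : 0 ≤ maxDensity d D n :=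
  Real.sSup_nonneg fun _ ⟨_, _, _, hx⟩ => hx ▸ density_nonneg _ _

theorem maxDensity_le_one (d : ℕ) (D : FinRootedTree) (n : ℕ) : maxDensity d D n ≤ 1 :=
  Real.sSup_le (fun _ ⟨_, _, _, hx⟩ => hx ▸ density_le_one _ _) zero_le_one

theorem density_le_maxDensity {d : ℕ} (D : FinRootedTree) {T : FinRootedTree} (hT : T.IsDAry d) :
    density D T ≤ maxDensity d D T.numLeaves :=
  le_csSup ⟨1, fun _ ⟨_, _, _, hx⟩ => hx ▸ density_le_one _ _⟩ ⟨T, hT, rfl, rfl⟩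

theorem isBoundedUnder_maxDensity (d : ℕ) (D : FinRootedTree) :
    Filter.IsBoundedUnder (· ≤ ·) Filter.atTop fun n : ℕ => maxDensity d D n :=
  Filter.isBoundedUnder_of ⟨1, maxDensity_le_one d D⟩

theorem isCoboundedUnder_maxDensity (d : ℕ) (D : FinRootedTree) :
    Filter.IsCoboundedUnder (· ≤ ·) Filter.atTop fun n : ℕ => maxDensity d D n :=
  (Filter.isBoundedUnder_of ⟨0, maxDensity_nonneg d D⟩ :
    Filter.IsBoundedUnder (· ≥ ·) Filter.atTop _).isCoboundedUnder_le

/-- Every `d`-ary tree gives a lower bound for the inducibility, by blowing up its leaves. -/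
theorem copies_mul_factorial_div_pow_le_inducibility {d : ℕ} (hd : 2 ≤ d) {D : FinRootedTree}
    (hD : D.IsDAry d) {T : FinRootedTree} (hT : T.IsDAry d) :
    (copies D T : ℝ) * D.numLeaves.factorial / (T.numLeaves : ℝ) ^ D.numLeaves ≤
      inducibility d D := by
  refine Filter.le_limsup_of_frequently_le (Filter.frequently_atTop.2 fun a => ?_)
    (isBoundedUnder_maxDensity d D)
  -- This size makes the graft larger than `a`, as the limsup requires, and larger than `D`, so that
  -- the binomial coefficient is positive.
  obtain ⟨S, hS, hn⟩ := exists_isDAry_numLeaves hd (a + D.numLeaves)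
  have hTpos := hT.numLeaves_pos
  have hle : S.numLeaves ≤ T.numLeaves * S.numLeaves := Nat.le_mul_of_pos_left _ hTpos
  refine ⟨T.numLeaves * S.numLeaves, by omega, ?_⟩
  rw [← numLeaves_graft]
  refine le_trans ?_ (density_le_maxDensity D (hS.graft hT))
  have h1 : (copies D T : ℝ) * (S.numLeaves : ℝ) ^ D.numLeaves ≤ copies D (graft S T) := by
    exact_mod_cast copies_mul_pow_le_copies_graft S hD T
  have hSpos : (0 : ℝ) < S.numLeaves := by exact_mod_cast hS.numLeaves_pos
  have hTpos' : (0 : ℝ) < T.numLeaves := by exact_mod_cast hTpos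
  have hc : (0 : ℝ) < ((T.numLeaves * S.numLeaves).choose D.numLeaves : ℝ) := by
    exact_mod_cast Nat.choose_pos (by omega)
  have h2 := Nat.choose_le_pow_div (α := ℝ) D.numLeaves (T.numLeaves * S.numLeaves)
  have hf : (0 : ℝ) < D.numLeaves.factorial := by exact_mod_cast Nat.factorial_pos _
  rw [density, numLeaves_graft, le_div_iff₀ hc]
  refine le_trans ?_ h1
  push_cast at h2
  calc _ ≤ (copies D T : ℝ) * D.numLeaves.factorial / (T.numLeaves : ℝ) ^ D.numLeaves *
        (((T.numLeaves : ℝ) * S.numLeaves) ^ D.numLeaves / D.numLeaves.factorial) := by gcongr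
    _ = _ := by rw [mul_pow]; field_simp

end FinRootedTree

/-! ### A Muirhead-type inequality -/

section Muirhead

variable {ι : Type*} [Fintype ι] [DecidableEq ι]

/-- The symmetrized monomial with exponents `μ`. -/
def symmMonomial (x : ι → ℝ) (μ : ι → ℕ) : ℝ :=
  ∑ τ : Equiv.Perm ι, ∏ i, x (τ i) ^ μ i

theorem mul_pow_add_mul_pow_le {u v : ℝ} (hu : 0 ≤ u) (hv : 0 ≤ v) {p q : ℕ} (h : q ≤ p) :
    u ^ p * v ^ (q + 1) + v ^ p * u ^ (q + 1) ≤ u ^ (p + 1) * v ^ q + v ^ (p + 1) * u ^ q := by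
  obtain ⟨n, rfl⟩ := Nat.exists_eq_add_of_le h
  -- The two sides of the claim differ by this product times `(u * v) ^ q`.
  have key : 0 ≤ (u ^ n - v ^ n) * (u - v) := by
    rcases le_total u v with huv | huv
    · exact mul_nonneg_of_nonpos_of_nonpos (sub_nonpos.2 (pow_le_pow_left₀ hu huv n))
        (sub_nonpos.2 huv)
    · exact mul_nonneg (sub_nonneg.2 (pow_le_pow_left₀ hv huv n)) (sub_nonneg.2 huv)
  have h2 : 0 ≤ (u * v) ^ q * ((u ^ n - v ^ n) * (u - v)) := mul_nonneg (by positivity) key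
  have : (u * v) ^ q * ((u ^ n - v ^ n) * (u - v)) =
      u ^ (q + n + 1) * v ^ q + v ^ (q + n + 1) * u ^ q -
        (u ^ (q + n) * v ^ (q + 1) + v ^ (q + n) * u ^ (q + 1)) := by
    rw [mul_pow]; ring
  linarith

/-- Moving one unit from a larger exponent to a smaller one decreases a symmetrized monomial. -/
theorem symmMonomial_le_of_transfer {x : ι → ℝ} (hx : ∀ i, 0 ≤ x i) {μ ν : ι → ℕ} {i j : ι}
    (hij : i ≠ j) (hi : μ i = ν i + 1) (hj : ν j = μ j + 1)
    (hl : ∀ l, l ≠ i → l ≠ j → ν l = μ l) (hle : μ j ≤ ν i) :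
    symmMonomial x ν ≤ symmMonomial x μ := by
  -- Pairing `τ` with `τ * swap i j` isolates two variables, and the two-variable inequality applies
  -- to each pair.
  have hdouble : ∀ κ : ι → ℕ, 2 * symmMonomial x κ = ∑ τ : Equiv.Perm ι,
      (∏ l, x (τ l) ^ κ l + ∏ l, x ((τ * Equiv.swap i j) l) ^ κ l) := fun κ => by
    rw [Finset.sum_add_distrib, two_mul]
    congr 1
    exact (Equiv.sum_comp (Equiv.mulRight (Equiv.swap i j))
      (fun τ : Equiv.Perm ι => ∏ l, x (τ l) ^ κ l)).symm
  have hfac : ∀ f : ι → ℝ, ∏ l, f l = f i * f j * ∏ l ∈ (Finset.univ.erase i).erase j, f l :=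
    fun f => by
      rw [mul_assoc, Finset.mul_prod_erase _ _ (by simp [hij.symm]),
        Finset.mul_prod_erase _ _ (Finset.mem_univ i)]
  suffices 2 * symmMonomial x ν ≤ 2 * symmMonomial x μ by linarith
  rw [hdouble, hdouble]
  refine Finset.sum_le_sum fun τ _ => ?_
  rw [hfac, hfac (fun l => x ((τ * Equiv.swap i j) l) ^ ν l), hfac (fun l => x (τ l) ^ μ l),
    hfac (fun l => x ((τ * Equiv.swap i j) l) ^ μ l)]
  have hR : ∀ κ : ι → ℕ, ∏ l ∈ (Finset.univ.erase i).erase j, x ((τ * Equiv.swap i j) l) ^ κ l =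
      ∏ l ∈ (Finset.univ.erase i).erase j, x (τ l) ^ κ l := fun κ => by
    refine Finset.prod_congr rfl fun l hl' => ?_
    simp only [Finset.mem_erase] at hl'
    rw [Equiv.Perm.mul_apply, Equiv.swap_apply_of_ne_of_ne hl'.2.1 hl'.1]
  have hν : ∏ l ∈ (Finset.univ.erase i).erase j, x (τ l) ^ ν l =
      ∏ l ∈ (Finset.univ.erase i).erase j, x (τ l) ^ μ l := by
    refine Finset.prod_congr rfl fun l hl' => ?_
    simp only [Finset.mem_erase] at hl'
    rw [hl l hl'.2.1 hl'.1]
  rw [hR, hR, hν, ← add_mul, ← add_mul]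
  refine mul_le_mul_of_nonneg_right ?_ (Finset.prod_nonneg fun l _ => pow_nonneg (hx _) _)
  simp only [Equiv.Perm.mul_apply, Equiv.swap_apply_left, Equiv.swap_apply_right]
  rw [hi, hj]
  exact mul_pow_add_mul_pow_le (hx _) (hx _) hle

/-- Among the symmetrized monomials of given degree, the balanced one is the smallest. -/
theorem symmMonomial_le_of_balanced {x : ι → ℝ} (hx : ∀ i, 0 ≤ x i) {κ : ι → ℕ}
    (hκ : ∀ i j, κ i ≤ κ j + 1) {μ : ι → ℕ} (hsum : ∑ i, μ i = ∑ i, κ i) :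
    symmMonomial x κ ≤ symmMonomial x μ := by
  -- With truncated subtraction this is the total excess of `μ` over `κ`; a transfer from an index
  -- in excess to one in deficit lowers it by one.
  induction h : ∑ i, (μ i - κ i) using Nat.strong_induction_on generalizing μ with
  | _ n ih =>
    by_cases hex : ∃ i, κ i < μ i
    · obtain ⟨i, hi⟩ := hex
      have hex' : ∃ j, μ j < κ j := by
        by_contra! hcon
        exact absurd hsum (Finset.sum_lt_sum (fun j _ => hcon j) ⟨i, Finset.mem_univ i, hi⟩).ne'
      obtain ⟨j, hj⟩ := hex'
      have hij : i ≠ j := by rintro rfl; omega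
      let ν : ι → ℕ := fun l => if l = i then μ i - 1 else if l = j then μ j + 1 else μ l
      have hνi : ν i = μ i - 1 := by simp [ν]
      have hνj : ν j = μ j + 1 := by simp [ν, hij.symm]
      have hνl : ∀ l, l ≠ i → l ≠ j → ν l = μ l := fun l h1 h2 => by simp [ν, h1, h2]
      have hfac : ∀ f : ι → ℕ, ∑ l, f l = f i + f j + ∑ l ∈ (Finset.univ.erase i).erase j, f l :=
        fun f => by
          rw [add_assoc, Finset.add_sum_erase _ _ (by simp [hij.symm]),
            Finset.add_sum_erase _ _ (Finset.mem_univ i)]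
      have hrest : ∀ g : ι → ℕ → ℕ, ∑ l ∈ (Finset.univ.erase i).erase j, g l (ν l) =
          ∑ l ∈ (Finset.univ.erase i).erase j, g l (μ l) := fun g => by
        refine Finset.sum_congr rfl fun l hl' => ?_
        simp only [Finset.mem_erase] at hl'
        rw [hνl l hl'.2.1 hl'.1]
      -- Balance enters here: μ j + 1 ≤ κ j ≤ κ i + 1 ≤ μ i, so the transfer goes in the direction
      -- that decreases the symmetrized monomial.
      have hκij := hκ j i
      refine le_trans (ih (∑ l, (ν l - κ l)) ?_ ?_ rfl)
        (symmMonomial_le_of_transfer hx hij (by omega) hνj hνl (by omega))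
      · rw [← h, hfac, hfac (fun l => μ l - κ l), hrest (fun l a => a - κ l), hνi, hνj]
        omega
      · rw [← hsum, hfac, hfac μ, hrest (fun _ a => a), hνi, hνj]
        omega
    · push Not at hex
      have : μ = κ := by
        funext i
        exact (Finset.sum_eq_sum_iff_of_le fun i _ => hex i).1 hsum i (Finset.mem_univ i)
      rw [this]

theorem prod_comp_eq_prod_pow_card {m : ℕ} (y : ι → ℝ) (w : Fin m → ι) :
    ∏ t, y (w t) = ∏ i, y i ^ (Finset.univ.filter fun t => w t = i).card := by
  rw [← Finset.prod_fiberwise (s := Finset.univ) (g := w)]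
  refine Finset.prod_congr rfl fun i _ => ?_
  rw [Finset.prod_congr rfl (g := fun _ => y i), Finset.prod_const]
  intro t ht
  rw [(Finset.mem_filter.1 ht).2]

/-- Expanding the power gives one monomial for each word of length `m`; subtracting the pure powers
removes the constant words, and `card ^ m - card` words remain. After averaging over permutations of
the variables, each contributes at least the balanced symmetrized monomial. -/
theorem mul_symmMonomial_le {x : ι → ℝ} (hx : ∀ i, 0 ≤ x i) {κ : ι → ℕ}
    (hκ : ∀ i j, κ i ≤ κ j + 1) {m : ℕ} (hm : 0 < m) (hsum : ∑ i, κ i = m) :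
    ((Fintype.card ι : ℝ) ^ m - Fintype.card ι) * symmMonomial x κ ≤
      (Fintype.card ι).factorial * ((∑ i, x i) ^ m - ∑ i, x i ^ m) := by
  classical
  let C : Finset (Fin m → ι) := Finset.univ.image fun i _ => i
  have hinj : Function.Injective fun (i : ι) (_ : Fin m) => i :=
    fun a b hab => congrFun hab ⟨0, hm⟩
  have hsumC : ∀ y : ι → ℝ, ∑ w ∈ Cᶜ, ∏ t, y (w t) = (∑ i, y i) ^ m - ∑ i, y i ^ m := fun y => by
    rw [Fintype.sum_pow, ← Finset.sum_compl_add_sum C, Finset.sum_image hinj.injOn]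
    simp
  have hcard : ((Cᶜ).card : ℝ) = (Fintype.card ι : ℝ) ^ m - Fintype.card ι := by
    have := hsumC fun _ => 1
    simpa using this
  have hperm : ∀ τ : Equiv.Perm ι, ∑ w ∈ Cᶜ, ∏ t, x (τ (w t)) =
      (∑ i, x i) ^ m - ∑ i, x i ^ m := fun τ => by
    rw [hsumC fun i => x (τ i), Equiv.sum_comp τ x, Equiv.sum_comp τ fun i => x i ^ m]
  calc _ = ∑ w ∈ Cᶜ, symmMonomial x κ := by rw [Finset.sum_const, nsmul_eq_mul, hcard]
    _ ≤ ∑ w ∈ Cᶜ, symmMonomial x fun i => (Finset.univ.filter fun t => w t = i).card := by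
      refine Finset.sum_le_sum fun w _ => symmMonomial_le_of_balanced hx hκ ?_
      rw [hsum, ← Finset.card_eq_sum_card_fiberwise fun _ _ => Finset.mem_coe.2 (Finset.mem_univ _)]
      simp
    _ = ∑ τ : Equiv.Perm ι, ∑ w ∈ Cᶜ, ∏ t, x (τ (w t)) := by
      rw [Finset.sum_comm]
      refine Finset.sum_congr rfl fun w _ => Finset.sum_congr rfl fun τ _ => ?_
      exact (prod_comp_eq_prod_pow_card (fun i => x (τ i)) w).symm
    _ = _ := by
      rw [Finset.sum_congr rfl fun τ _ => hperm τ, Finset.sum_const, nsmul_eq_mul,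
        Finset.card_univ, Fintype.card_perm]

/-- Exponents that are as equal as possible when extended by zero to `d` indices. -/
def IsBalanced (d : ℕ) {r : ℕ} (κ : Fin r → ℕ) : Prop :=
  (∀ i j, κ i ≤ κ j + 1) ∧ (r = d ∨ ∀ j, κ j ≤ 1)

/-- Averaging over permutations of the variables turns each embedding into a symmetrized monomial
with exponents `κ` extended by zero. The second clause of `IsBalanced` keeps the extension balanced:
either no zeros are added, or all exponents are at most one. -/
theorem mul_sum_embedding_le {d r : ℕ} {x : Fin d → ℝ} (hx : ∀ i, 0 ≤ x i) {κ : Fin r → ℕ}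
    (hκ : IsBalanced d κ) {m : ℕ} (hm : 0 < m) (hsum : ∑ j, κ j = m) :
    ((d : ℝ) ^ m - d) * ∑ σ : Fin r ↪ Fin d, ∏ j, x (σ j) ^ κ j ≤
      Fintype.card (Fin r ↪ Fin d) * ((∑ i, x i) ^ m - ∑ i, x i ^ m) := by
  have hshift : ∀ ρ : Equiv.Perm (Fin d), ∑ σ : Fin r ↪ Fin d, ∏ j, x (ρ (σ j)) ^ κ j =
      ∑ σ : Fin r ↪ Fin d, ∏ j, x (σ j) ^ κ j := fun ρ =>
    Equiv.sum_comp (Equiv.embeddingCongr (Equiv.refl (Fin r)) ρ)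
      fun σ : Fin r ↪ Fin d => ∏ j, x (σ j) ^ κ j
  have hfac : (0 : ℝ) < (d.factorial : ℝ) := by exact_mod_cast d.factorial_pos
  have hdouble : (d.factorial : ℝ) * ∑ σ : Fin r ↪ Fin d, ∏ j, x (σ j) ^ κ j =
      ∑ σ : Fin r ↪ Fin d, symmMonomial x (Function.extend σ κ 0) := by
    calc _ = ∑ ρ : Equiv.Perm (Fin d), ∑ σ : Fin r ↪ Fin d, ∏ j, x (ρ (σ j)) ^ κ j := by
          rw [Finset.sum_congr rfl fun ρ _ => hshift ρ, Finset.sum_const, nsmul_eq_mul,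
            Finset.card_univ, Fintype.card_perm, Fintype.card_fin]
      _ = _ := by
          rw [Finset.sum_comm]
          refine Finset.sum_congr rfl fun σ _ => Finset.sum_congr rfl fun ρ _ => ?_
          refine Fintype.prod_of_injective σ σ.injective _ _ (fun i hi => ?_) fun j => ?_
          · rw [Function.extend_apply' _ _ _ (by simpa using hi)]
            simp
          · rw [σ.injective.extend_apply]
  have hterm : ∀ σ : Fin r ↪ Fin d, ((d : ℝ) ^ m - d) * symmMonomial x (Function.extend σ κ 0) ≤
      d.factorial * ((∑ i, x i) ^ m - ∑ i, x i ^ m) := fun σ => by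
    have hout : ∀ i, i ∉ Set.range σ → Function.extend σ κ 0 i = 0 := fun i hi => by
      rw [Function.extend_apply' _ _ _ (by simpa using hi)]; rfl
    have := mul_symmMonomial_le hx (κ := Function.extend σ κ 0) (fun i j => ?_) hm ?_
    · simpa using this
    · by_cases hi : i ∈ Set.range σ
      · obtain ⟨a, rfl⟩ := hi
        rw [σ.injective.extend_apply]
        by_cases hj : j ∈ Set.range σ
        · obtain ⟨b, rfl⟩ := hj
          rw [σ.injective.extend_apply]
          exact hκ.1 a b
        · rcases hκ.2 with rfl | h1
          · exact absurd (Finite.surjective_of_injective σ.injective j) (by simpa using hj)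
          · exact (h1 a).trans (by omega)
      · rw [hout i hi]
        exact Nat.zero_le _
    · rw [← hsum]
      symm
      exact Fintype.sum_of_injective σ σ.injective _ _ hout
        fun j => (σ.injective.extend_apply _ _ _).symm
  refine le_of_mul_le_mul_left ?_ hfac
  calc _ = ∑ σ : Fin r ↪ Fin d, ((d : ℝ) ^ m - d) * symmMonomial x (Function.extend σ κ 0) := by
        rw [← Finset.mul_sum, ← hdouble]; ring
    _ ≤ ∑ σ : Fin r ↪ Fin d, d.factorial * ((∑ i, x i) ^ m - ∑ i, x i ^ m) :=
        Finset.sum_le_sum fun σ _ => hterm σ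
    _ = _ := by rw [Finset.sum_const, nsmul_eq_mul, Finset.card_univ]; ring

/-- Vertices with fewer than `d` children are covered by padding with variables equal to zero: the
power sums on the right do not change, and the left side does not decrease. -/
theorem mul_sum_embedding_le_of_le {d r l : ℕ} (hl : l ≤ d) {x : Fin l → ℝ} (hx : ∀ i, 0 ≤ x i)
    {κ : Fin r → ℕ} (hκ : IsBalanced d κ) {m : ℕ} (hm : 0 < m) (hd : 0 < d)
    (hsum : ∑ j, κ j = m) :
    ((d : ℝ) ^ m - d) * ∑ σ : Fin r ↪ Fin l, ∏ j, x (σ j) ^ κ j ≤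
      Fintype.card (Fin r ↪ Fin d) * ((∑ i, x i) ^ m - ∑ i, x i ^ m) := by
  let y : Fin d → ℝ := fun i => if h : (i : ℕ) < l then x ⟨i, h⟩ else 0
  have hy : ∀ i, 0 ≤ y i := fun i => by
    by_cases h : (i : ℕ) < l <;> simp [y, h, hx]
  have hyx : ∀ i : Fin l, y (Fin.castLE hl i) = x i := fun i => by simp [y]
  have hout : ∀ i, i ∉ Set.range (Fin.castLE hl) → y i = 0 := fun i hi => by
    have : ¬ (i : ℕ) < l := fun h => hi ⟨⟨i, h⟩, rfl⟩
    simp [y, this]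
  have hpow : ∀ p : ℕ, 0 < p → ∑ i, x i ^ p = ∑ i, y i ^ p := fun p hp =>
    Fintype.sum_of_injective (Fin.castLE hl) (Fin.castLE_injective hl) _ _
      (fun i hi => by rw [hout i hi, zero_pow hp.ne']) fun i => by rw [hyx]
  have h1 : ∑ i, x i = ∑ i, y i := by simpa using hpow 1 one_pos
  have hnn : (0 : ℝ) ≤ (d : ℝ) ^ m - d :=
    sub_nonneg.2 (le_self_pow₀ (by exact_mod_cast hd) hm.ne')
  rw [h1, hpow m hm]
  refine le_trans (mul_le_mul_of_nonneg_left ?_ hnn) (mul_sum_embedding_le hy hκ hm hsum)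
  let ε : (Fin r ↪ Fin l) ↪ (Fin r ↪ Fin d) :=
    ⟨fun σ => σ.trans (Fin.castLEEmb hl), fun σ τ h => Function.Embedding.ext fun j =>
      Fin.castLE_injective hl (DFunLike.congr_fun h j)⟩
  calc ∑ σ : Fin r ↪ Fin l, ∏ j, x (σ j) ^ κ j
      = ∑ σ ∈ Finset.univ.map ε, ∏ j, y (σ j) ^ κ j := by
        rw [Finset.sum_map]
        refine Finset.sum_congr rfl fun σ _ => Finset.prod_congr rfl fun j _ => ?_
        rw [← hyx]; rfl
    _ ≤ _ := Finset.sum_le_sum_of_subset_of_nonneg (Finset.subset_univ _)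
        fun σ _ _ => Finset.prod_nonneg fun j _ => pow_nonneg (hy _) _

end Muirhead

/-! ### Arithmetic of error terms and auxiliary sums -/

open Asymptotics Filter

theorem isBigO_prod_sub_prod {X J : Type*} {l : Filter X} {e : X → ℝ}
    (he : e =O[l] fun _ => (1 : ℝ)) (s : Finset J) {f : J → X → ℝ} {a : J → ℝ}
    (h : ∀ j ∈ s, (fun x => f j x - a j) =O[l] e) :
    (fun x => ∏ j ∈ s, f j x - ∏ j ∈ s, a j) =O[l] e := by
  classical
  induction s using Finset.induction_on with
  | empty => simpa using isBigO_zero e l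
  | insert i s hi ih =>
    have h1 := h i (Finset.mem_insert_self _ _)
    have h2 := ih fun j hj => h j (Finset.mem_insert_of_mem hj)
    have h3 : (fun x => ∏ j ∈ s, f j x) =O[l] fun _ => (1 : ℝ) := by
      have := (h2.trans he).add (isBigO_const_const (∏ j ∈ s, a j) (one_ne_zero (α := ℝ)) l)
      simpa using this
    have h4 := h1.mul h3
    simp only [mul_one] at h4
    have h4 := h4.add (h2.const_mul_left (a i))
    refine h4.congr_left fun x => ?_
    rw [Finset.prod_insert hi, Finset.prod_insert hi]
    ring

theorem isBigO_pow_sub_pow {X : Type*} {l : Filter X} {e : X → ℝ}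
    (he : e =O[l] fun _ => (1 : ℝ)) {f : X → ℝ} {a : ℝ} (h : (fun x => f x - a) =O[l] e) (m : ℕ) :
    (fun x => f x ^ m - a ^ m) =O[l] e := by
  simpa using isBigO_prod_sub_prod he (Finset.range m) (f := fun _ => f) (a := fun _ => a)
    fun _ _ => h

theorem isBigO_mul_sub_mul {X : Type*} {l : Filter X} {e : X → ℝ}
    (he : e =O[l] fun _ => (1 : ℝ)) {f g : X → ℝ} {a b : ℝ} (hf : (fun x => f x - a) =O[l] e)
    (hg : (fun x => g x - b) =O[l] e) : (fun x => f x * g x - a * b) =O[l] e := by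
  have := isBigO_prod_sub_prod he (Finset.univ : Finset (Fin 2)) (f := ![f, g]) (a := ![a, b])
    (fun j _ => by fin_cases j <;> assumption)
  simpa using this

theorem sum_embedding_fin_two {l : ℕ} (y : Fin l → ℝ) :
    ∑ σ : Fin 2 ↪ Fin l, ∏ j, y (σ j) = (∑ i, y i) ^ 2 - ∑ i, y i ^ 2 := by
  classical
  let ε : (Fin 2 ↪ Fin l) ↪ Fin l × Fin l :=
    ⟨fun σ => (σ 0, σ 1), fun σ τ h => by
      ext j
      fin_cases j
      · exact congrArg (fun p => (p.1 : ℕ)) h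
      · exact congrArg (fun p => (p.2 : ℕ)) h⟩
  have hε : Finset.univ.map ε = (Finset.univ : Finset (Fin l)).offDiag := by
    ext ⟨i, j⟩
    simp only [Finset.mem_map, Finset.mem_univ, true_and, Finset.mem_offDiag]
    constructor
    · rintro ⟨σ, hσ⟩
      have h0 : σ 0 = i := congrArg Prod.fst hσ
      have h1 : σ 1 = j := congrArg Prod.snd hσ
      rw [← h0, ← h1]
      exact fun h => absurd (σ.injective h) (by simp)
    · intro hij
      refine ⟨⟨![i, j], ?_⟩, rfl⟩
      intro a b
      fin_cases a <;> fin_cases b <;> simp [hij, hij.symm]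
  have h1 : ∑ σ : Fin 2 ↪ Fin l, ∏ j, y (σ j) =
      ∑ p ∈ (Finset.univ : Finset (Fin l)).offDiag, y p.1 * y p.2 := by
    rw [← hε, Finset.sum_map]
    exact Finset.sum_congr rfl fun σ _ => by rw [Fin.prod_univ_two]; rfl
  have h2 : ∑ i, y i ^ 2 = ∑ p ∈ (Finset.univ : Finset (Fin l)).diag, y p.1 * y p.2 := by
    rw [Finset.sum_diag]
    exact Finset.sum_congr rfl fun i _ => sq _
  rw [h1, h2, eq_sub_iff_add_eq, add_comm, ← Finset.sum_union (Finset.disjoint_diag_offDiag _),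
    Finset.diag_union_offDiag, Finset.sum_product, sq, Finset.sum_mul_sum]

theorem Fin.sum_ite_val_lt (d a s t : ℕ) (ha : a ≤ d) :
    ∑ i : Fin d, (if (i : ℕ) < a then s else t) = a * s + (d - a) * t := by
  obtain ⟨b, rfl⟩ := Nat.exists_eq_add_of_le ha
  rw [Fin.sum_univ_add]
  simp

/-! ### The trees H_n^d: branches and their sizes -/

namespace FinRootedTree

theorem copies_node_node_real {k r : ℕ} (hr : 2 ≤ r) (c : Fin k → FinRootedTree)
    (D : Fin r → FinRootedTree) :
    (copies (node r D) (node k c) : ℝ) = ∑ i, (copies (node r D) (c i) : ℝ) +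
        (branchSymm D : ℝ)⁻¹ * ∑ σ : Fin r ↪ Fin k, ∏ j, (copies (D j) (c (σ j)) : ℝ) := by
  have h := copies_node_node hr c D
  have hA : (branchSymm D : ℝ) ≠ 0 := by exact_mod_cast (branchSymm_pos D).ne'
  have h' : (branchSymm D : ℝ) * copies (node r D) (node k c) =
      branchSymm D * ∑ i, (copies (node r D) (c i) : ℝ) +
        ∑ σ : Fin r ↪ Fin k, ∏ j, (copies (D j) (c (σ j)) : ℝ) := by exact_mod_cast h
  rw [← mul_right_inj' hA, h', mul_add, mul_inv_cancel_left₀ hA]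

/-- The index of the `i`-th branch of `H_{n+1}^d`. -/
def branchIndex (d n : ℕ) (i : Fin d) : ℕ := if (i : ℕ) < d - n % d then n / d else n / d + 1

theorem strictEven_zero (d : ℕ) : strictEven d 0 = leaf := by rw [strictEven]

theorem strictEven_succ (d n : ℕ) :
    strictEven d (n + 1) = node d fun i => strictEven d (branchIndex d n i) := by
  rw [strictEven]
  congr 1
  funext i
  unfold branchIndex
  split_ifs <;> rfl

theorem sum_branchIndex {d : ℕ} (hd : 0 < d) (n : ℕ) : ∑ i, branchIndex d n i = n := by
  unfold branchIndex
  rw [Fin.sum_ite_val_lt _ _ _ _ (Nat.sub_le _ _), Nat.sub_sub_self (Nat.mod_lt n hd).le]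
  have h1 := Nat.div_add_mod n d
  have h2 : (d - n % d) * (n / d) + n % d * (n / d) = d * (n / d) := by
    rw [← add_mul, Nat.sub_add_cancel (Nat.mod_lt n hd).le]
  rw [mul_add]
  omega

theorem branchIndex_le {d : ℕ} (n : ℕ) (i : Fin d) : branchIndex d n i ≤ n := by
  have hd : 0 < d := i.pos
  refine le_of_le_of_eq ?_ (sum_branchIndex hd n)
  exact Finset.single_le_sum (f := branchIndex d n) (fun _ _ => Nat.zero_le _) (Finset.mem_univ i)

theorem le_mul_branchIndex {d : ℕ} (n : ℕ) (i : Fin d) : n ≤ d * branchIndex d n i + d := by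
  have h1 := Nat.div_add_mod n d
  have h2 := Nat.mod_lt n i.pos
  unfold branchIndex
  split_ifs
  · omega
  · rw [mul_add]; omega

theorem mul_branchIndex_le {d : ℕ} (n : ℕ) (i : Fin d) : d * branchIndex d n i ≤ n + d := by
  have h1 := Nat.div_add_mod n d
  unfold branchIndex
  split_ifs
  · omega
  · rw [mul_add]; omega

/-- Every branch of `H_{n+1}^d` has index at most `(n + 1) / 2`. -/
theorem two_mul_branchIndex_le {d : ℕ} (hd : 2 ≤ d) (n : ℕ) (i : Fin d) :
    2 * branchIndex d n i ≤ n + 1 := by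
  have h1 := Nat.div_add_mod n d
  have h3 : 2 * (n / d) ≤ d * (n / d) := Nat.mul_le_mul_right _ hd
  unfold branchIndex
  split_ifs with h
  · omega
  · have := i.2
    omega

theorem numLeaves_strictEven {d : ℕ} (hd : 2 ≤ d) (n : ℕ) :
    (strictEven d n).numLeaves = (d - 1) * n + 1 := by
  induction n using Nat.strong_induction_on with
  | _ n ih =>
    match n with
    | 0 => simp [strictEven_zero]
    | n + 1 =>
      rw [strictEven_succ, numLeaves_node,
        Finset.sum_congr rfl fun i _ => ih _ (Nat.lt_succ_of_le (branchIndex_le n i)),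
        Finset.sum_add_distrib, ← Finset.mul_sum, sum_branchIndex (by omega)]
      simp only [Finset.sum_const, Finset.card_univ, Fintype.card_fin, smul_eq_mul, mul_one]
      rw [mul_add]
      omega

theorem isStrictlyDAry_strictEven (d n : ℕ) : (strictEven d n).IsStrictlyDAry d := by
  induction n using Nat.strong_induction_on with
  | _ n ih =>
    match n with
    | 0 => simp [strictEven_zero, IsStrictlyDAry]
    | n + 1 =>
      rw [strictEven_succ, IsStrictlyDAry]
      exact ⟨rfl, fun i => ih _ (Nat.lt_succ_of_le (branchIndex_le n i))⟩

theorem IsStrictlyDAry.isDAry {d : ℕ} (hd : 2 ≤ d) :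
    ∀ {T : FinRootedTree}, T.IsStrictlyDAry d → T.IsDAry d
  | leaf, _ => by simp [IsDAry]
  | node k c, h => by
    simp only [IsStrictlyDAry] at h
    simp only [IsDAry]
    exact ⟨by omega, by omega, fun i => (h.2 i).isDAry hd⟩

/-- The number of leaves of `H_n^d` as a real number. -/
noncomputable def strictEvenSize (d n : ℕ) : ℝ := ((strictEven d n).numLeaves : ℝ)

theorem strictEvenSize_eq {d : ℕ} (hd : 2 ≤ d) (n : ℕ) :
    strictEvenSize d n = ((d : ℝ) - 1) * n + 1 := by
  rw [strictEvenSize, numLeaves_strictEven hd]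
  push_cast [Nat.cast_sub (show 1 ≤ d by omega)]
  rfl

theorem one_le_strictEvenSize {d : ℕ} (hd : 2 ≤ d) (n : ℕ) : 1 ≤ strictEvenSize d n := by
  rw [strictEvenSize, numLeaves_strictEven hd]
  push_cast
  linarith [show (0 : ℝ) ≤ ((d - 1 : ℕ) : ℝ) * n by positivity]

theorem strictEvenSize_pos {d : ℕ} (hd : 2 ≤ d) (n : ℕ) : 0 < strictEvenSize d n :=
  one_pos.trans_le (one_le_strictEvenSize hd n)

theorem le_strictEvenSize {d : ℕ} (hd : 2 ≤ d) (n : ℕ) : (n : ℝ) ≤ strictEvenSize d n := by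
  rw [strictEvenSize_eq hd]
  have : (2 : ℝ) ≤ d := by exact_mod_cast hd
  nlinarith [(Nat.cast_nonneg n : (0 : ℝ) ≤ n)]

theorem sum_strictEvenSize_branch (d n : ℕ) :
    ∑ i, strictEvenSize d (branchIndex d n i) = strictEvenSize d (n + 1) := by
  simp only [strictEvenSize]
  rw [strictEven_succ, numLeaves_node]
  push_cast
  rfl

/-- Any ratio below 1 would serve to contract the error in `exists_bound_of_recursion`. The value
2/3 is attained for d = 2, n = 1: three leaves, two of them in one branch. -/
theorem strictEvenSize_branch_le {d : ℕ} (hd : 2 ≤ d) (n : ℕ) (i : Fin d) :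
    strictEvenSize d (branchIndex d n i) ≤ 2 / 3 * strictEvenSize d (n + 1) := by
  rw [strictEvenSize_eq hd, strictEvenSize_eq hd]
  have hd' : (2 : ℝ) ≤ d := by exact_mod_cast hd
  have h : (2 : ℝ) * branchIndex d n i ≤ n + 1 := by exact_mod_cast two_mul_branchIndex_le hd n i
  push_cast
  rcases Nat.eq_zero_or_pos n with rfl | hn
  · have : branchIndex d 0 i = 0 := Nat.le_zero.1 (branchIndex_le 0 i)
    rw [this]
    push_cast
    linarith
  · have hn' : (1 : ℝ) ≤ n := by exact_mod_cast hn
    nlinarith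

theorem abs_mul_strictEvenSize_branch_sub_le {d : ℕ} (hd : 2 ≤ d) (n : ℕ) (i : Fin d) :
    |d * strictEvenSize d (branchIndex d n i) - strictEvenSize d (n + 1)| ≤ 2 * d ^ 2 := by
  rw [strictEvenSize_eq hd, strictEvenSize_eq hd, abs_le]
  have hd' : (2 : ℝ) ≤ d := by exact_mod_cast hd
  have h1 : (n : ℝ) ≤ d * branchIndex d n i + d := by exact_mod_cast le_mul_branchIndex n i
  have h2 : (d : ℝ) * branchIndex d n i ≤ n + d := by exact_mod_cast mul_branchIndex_le n i
  push_cast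
  constructor <;> nlinarith

theorem isBigO_inv_strictEvenSize_one {d : ℕ} (hd : 2 ≤ d) (l : Filter ℕ) :
    (fun n => (strictEvenSize d n)⁻¹) =O[l] fun _ => (1 : ℝ) := by
  refine IsBigO.of_bound 1 (Eventually.of_forall fun n => ?_)
  rw [norm_inv, Real.norm_of_nonneg (strictEvenSize_pos hd n).le, norm_one, mul_one]
  exact inv_le_one_of_one_le₀ (one_le_strictEvenSize hd n)

theorem isBigO_inv_strictEvenSize_branch {d : ℕ} (hd : 2 ≤ d) (i : Fin d) :
    (fun n => (strictEvenSize d (branchIndex d n i))⁻¹) =O[⊤]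
      fun n => (strictEvenSize d (n + 1))⁻¹ := by
  -- The whole tree has at most d s + 2 d² leaves, where s ≥ 1 is the size of the branch, and this
  -- is at most 3 d² s.
  refine IsBigO.of_bound (3 * d ^ 2) (Eventually.of_forall fun n => ?_)
  have h0 := strictEvenSize_pos hd (branchIndex d n i)
  have h1 := strictEvenSize_pos hd (n + 1)
  have h2 := one_le_strictEvenSize hd (branchIndex d n i)
  have hd' : (2 : ℝ) ≤ d := by exact_mod_cast hd
  rw [Real.norm_of_nonneg (inv_pos.2 h0).le, Real.norm_of_nonneg (inv_pos.2 h1).le,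
    ← div_eq_mul_inv, inv_le_comm₀ h0 (by positivity), inv_div, div_le_iff₀ (by positivity)]
  have := (abs_le.1 (abs_mul_strictEvenSize_branch_sub_le hd n i)).1
  nlinarith [mul_nonneg (sq_nonneg (d : ℝ)) (sub_nonneg.2 h2)]

theorem isBigO_strictEvenSize_branch_div {d : ℕ} (hd : 2 ≤ d) (i : Fin d) :
    (fun n => strictEvenSize d (branchIndex d n i) / strictEvenSize d (n + 1) - (d : ℝ)⁻¹) =O[⊤]
      fun n => (strictEvenSize d (n + 1))⁻¹ := by
  refine IsBigO.of_bound (2 * d) (Eventually.of_forall fun n => ?_)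
  have h1 := strictEvenSize_pos hd (n + 1)
  have hd' : (0 : ℝ) < d := by exact_mod_cast (show 0 < d by omega)
  have h := abs_mul_strictEvenSize_branch_sub_le hd n i
  rw [Real.norm_of_nonneg (inv_pos.2 h1).le, Real.norm_eq_abs]
  have : strictEvenSize d (branchIndex d n i) / strictEvenSize d (n + 1) - (d : ℝ)⁻¹ =
      (d * strictEvenSize d (branchIndex d n i) - strictEvenSize d (n + 1)) *
        ((d : ℝ)⁻¹ * (strictEvenSize d (n + 1))⁻¹) := by
    field_simp
  rw [this, abs_mul, abs_of_pos (a := (d : ℝ)⁻¹ * _) (by positivity)]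
  calc _ ≤ 2 * (d : ℝ) ^ 2 * ((d : ℝ)⁻¹ * (strictEvenSize d (n + 1))⁻¹) := by gcongr
    _ = _ := by field_simp

/-! ### Leading coefficients for H_n^d -/

/-- The number of copies of `D` in `H_n^d` is `a ‖H_n^d‖ ^ ‖D‖ + O(‖H_n^d‖ ^ (‖D‖ - 1))`. -/
def HasLeadingCoeff (d : ℕ) (D : FinRootedTree) (a : ℝ) : Prop :=
  (fun n => (copies D (strictEven d n) : ℝ) / strictEvenSize d n ^ D.numLeaves - a) =O[⊤]
    fun n => (strictEvenSize d n)⁻¹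

theorem hasLeadingCoeff_leaf {d : ℕ} (hd : 2 ≤ d) : HasLeadingCoeff d leaf 1 := by
  have : ∀ n, (copies leaf (strictEven d n) : ℝ) / strictEvenSize d n ^ leaf.numLeaves - 1 = 0 :=
    fun n => by
      rw [copies_leaf, numLeaves_leaf, pow_one, ← strictEvenSize,
        div_self (strictEvenSize_pos hd n).ne', sub_self]
  simp only [HasLeadingCoeff, this]
  exact isBigO_zero _ _

theorem tendsto_strictEvenSize {d : ℕ} (hd : 2 ≤ d) :
    Tendsto (strictEvenSize d) atTop atTop :=
  tendsto_atTop_mono (le_strictEvenSize hd) tendsto_natCast_atTop_atTop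

theorem HasLeadingCoeff.tendsto {d : ℕ} (hd : 2 ≤ d) {D : FinRootedTree} {a : ℝ}
    (h : HasLeadingCoeff d D a) :
    Tendsto (fun n => (copies D (strictEven d n) : ℝ) / strictEvenSize d n ^ D.numLeaves)
      atTop (nhds a) := by
  have := (h.mono le_top : _ =O[atTop] _).trans_tendsto (tendsto_strictEvenSize hd).inv_tendsto_atTop
  simpa using this.add_const a

/-- Since `HasLeadingCoeff` is stated along `⊤`, that is, uniformly in `n`, it can be composed with
`branchIndex` without any limit argument. -/
theorem isBigO_copies_branch {d : ℕ} (hd : 2 ≤ d) {D : FinRootedTree} {a : ℝ}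
    (h : HasLeadingCoeff d D a) (i : Fin d) :
    (fun n => (copies D (strictEven d (branchIndex d n i)) : ℝ) /
        strictEvenSize d (n + 1) ^ D.numLeaves - a * (d : ℝ)⁻¹ ^ D.numLeaves) =O[⊤]
      fun n => (strictEvenSize d (n + 1))⁻¹ := by
  have he : (fun n => (strictEvenSize d (n + 1))⁻¹) =O[⊤] fun _ => (1 : ℝ) :=
    (isBigO_inv_strictEvenSize_one hd ⊤).comp_tendsto (k := fun n => n + 1) tendsto_top
  have h1 := (h.comp_tendsto (k := fun n => branchIndex d n i) (l' := ⊤) tendsto_top).trans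
    (isBigO_inv_strictEvenSize_branch hd i)
  have h2 := isBigO_pow_sub_pow he (isBigO_strictEvenSize_branch_div hd i) D.numLeaves
  refine (isBigO_mul_sub_mul he h1 h2).congr_left fun n => ?_
  have h3 := (strictEvenSize_pos hd (n + 1)).ne'
  have h4 := (strictEvenSize_pos hd (branchIndex d n i)).ne'
  dsimp only
  rw [div_pow, div_mul_div_cancel₀ (pow_ne_zero _ h4)]

/-- For an exponent of at least 2, the powers of the branch sizes sum to at most 2/3 of the power of
the total, so inherited errors contract. With exponent 1 the sum would equal the total and the
argument would fail. -/
theorem exists_bound_of_recursion {d : ℕ} (hd : 2 ≤ d) {p : ℕ} {E : ℕ → ℝ} {C : ℝ}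
    (hE : ∀ n, |E (n + 1) - ∑ i, E (branchIndex d n i)| ≤ C * strictEvenSize d (n + 1) ^ (p + 2)) :
    ∃ C', ∀ n, |E n| ≤ C' * strictEvenSize d n ^ (p + 2) := by
  -- The induction step needs C + (2/3) K ≤ K, that is 3 C ≤ K; the other entry covers the single
  -- leaf, of size 1.
  refine ⟨max (3 * C) |E 0|, fun n => ?_⟩
  set K := max (3 * C) |E 0|
  have hK0 : 0 ≤ K := (abs_nonneg _).trans (le_max_right _ _)
  induction n using Nat.strong_induction_on with
  | _ n ih =>
    match n with
    | 0 =>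
      have : strictEvenSize d 0 = 1 := by simp [strictEvenSize, strictEven_zero]
      rw [this, one_pow, mul_one]
      exact le_max_right _ _
    | n + 1 =>
      set M := strictEvenSize d (n + 1)
      have hM : 0 < M := strictEvenSize_pos hd _
      have h1 : ∑ i, strictEvenSize d (branchIndex d n i) ^ (p + 2) ≤ 2 / 3 * M ^ (p + 2) := by
        calc _ ≤ ∑ i, strictEvenSize d (branchIndex d n i) * (2 / 3 * M ^ (p + 1)) := by
              refine Finset.sum_le_sum fun i _ => ?_
              have h0 := strictEvenSize_pos hd (branchIndex d n i)
              rw [pow_succ' _ (p + 1)]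
              refine mul_le_mul_of_nonneg_left ?_ h0.le
              calc _ ≤ (2 / 3 * M) ^ (p + 1) :=
                    pow_le_pow_left₀ h0.le (strictEvenSize_branch_le hd n i) _
                _ = (2 / 3) ^ (p + 1) * M ^ (p + 1) := mul_pow _ _ _
                _ ≤ _ := by
                  refine mul_le_mul_of_nonneg_right ?_ (by positivity)
                  exact pow_le_of_le_one (by norm_num) (by norm_num) (by omega)
          _ = _ := by rw [← Finset.sum_mul, sum_strictEvenSize_branch]; ring
      have h2 : |∑ i, E (branchIndex d n i)| ≤
          K * ∑ i, strictEvenSize d (branchIndex d n i) ^ (p + 2) := by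
        rw [Finset.mul_sum]
        exact (Finset.abs_sum_le_sum_abs _ _).trans (Finset.sum_le_sum fun i _ =>
          ih _ (Nat.lt_succ_of_le (branchIndex_le n i)))
      have h3 : |E (n + 1)| ≤ |E (n + 1) - ∑ i, E (branchIndex d n i)| +
          |∑ i, E (branchIndex d n i)| := by
        have := abs_add_le (E (n + 1) - ∑ i, E (branchIndex d n i)) (∑ i, E (branchIndex d n i))
        simpa using this
      have h4 : 3 * C ≤ K := le_max_left _ _
      have h5 : 0 ≤ M ^ (p + 2) := by positivity
      nlinarith [hE n, mul_le_mul_of_nonneg_left h1 hK0, mul_le_mul_of_nonneg_right h4 h5]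

/-- An exact count for m = 2, the case in which the error exponent m - 1 = 1 is too small for
`exists_bound_of_recursion`. -/
theorem branchSymm_mul_copies_of_leaves {D : Fin 2 → FinRootedTree} (hD : ∀ j, D j = leaf) :
    ∀ T : FinRootedTree, (branchSymm D : ℝ) * copies (node 2 D) T =
      (T.numLeaves : ℝ) ^ 2 - T.numLeaves
  | leaf => by simp [copies_node_leaf]
  | node k c => by
    have hA : (branchSymm D : ℝ) ≠ 0 := by exact_mod_cast (branchSymm_pos D).ne'
    rw [copies_node_node_real le_rfl, mul_add, mul_inv_cancel_left₀ hA, Finset.mul_sum,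
      Finset.sum_congr rfl fun i _ => branchSymm_mul_copies_of_leaves hD (c i),
      Finset.sum_congr rfl fun σ _ => Finset.prod_congr rfl fun j _ => by
        rw [hD j, copies_leaf],
      sum_embedding_fin_two fun i => ((c i).numLeaves : ℝ), numLeaves_node,
      Finset.sum_sub_distrib]
    push_cast
    ring

end FinRootedTree

/-! ### Powers versus binomial coefficients -/

/-- The factor between `n ^ m / m !` and the binomial coefficient is `1 + O(1 / n)`. -/
theorem isBigO_pow_div_choose_sub_one (m : ℕ) :
    (fun n : ℕ => (n : ℝ) ^ m / (m.factorial * n.choose m) - 1) =O[atTop] fun n : ℕ => (n : ℝ)⁻¹ := by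
  have he : (fun n : ℕ => (n : ℝ)⁻¹) =O[atTop] fun _ => (1 : ℝ) :=
    tendsto_inv_atTop_nhds_zero_nat.isBigO_one ℝ
  have h1 : (fun n : ℕ => ∏ i ∈ Finset.range m, (1 - (i : ℝ) * (n : ℝ)⁻¹) -
      ∏ i ∈ Finset.range m, (1 : ℝ)) =O[atTop] fun n : ℕ => (n : ℝ)⁻¹ := by
    refine isBigO_prod_sub_prod he _ fun i _ => ?_
    simp only [sub_sub_cancel_left]
    exact ((isBigO_refl _ _).const_mul_left _).neg_left
  simp only [Finset.prod_const_one] at h1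
  set u : ℕ → ℝ := fun n => ∏ i ∈ Finset.range m, (1 - (i : ℝ) * (n : ℝ)⁻¹)
  have hu : Tendsto u atTop (nhds 1) := by
    have := (h1.trans_tendsto tendsto_inv_atTop_nhds_zero_nat).add_const 1
    simpa using this
  have h2 : (fun n => (u n)⁻¹) =O[atTop] fun _ => (1 : ℝ) :=
    (hu.inv₀ one_ne_zero).isBigO_one ℝ
  have h3 := h1.neg_left.mul h2
  simp only [mul_one] at h3
  refine h3.congr' ?_ EventuallyEq.rfl
  filter_upwards [eventually_ge_atTop (m + 1), hu.eventually_ne one_ne_zero] with n hn hun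
  have hn0 : (n : ℝ) ≠ 0 := by exact_mod_cast (show n ≠ 0 by omega)
  have hdesc : (m.factorial : ℝ) * n.choose m = n ^ m * u n := by
    have : (m.factorial * n.choose m : ℕ) = ∏ i ∈ Finset.range m, (n - i) := by
      rw [← Nat.descFactorial_eq_factorial_mul_choose, Nat.descFactorial_eq_prod_range]
    have h : (m.factorial : ℝ) * n.choose m = ((∏ i ∈ Finset.range m, (n - i) : ℕ) : ℝ) := by
      exact_mod_cast this
    have hpow : (n : ℝ) ^ m = ∏ i ∈ Finset.range m, (n : ℝ) := by simp
    rw [h, hpow, ← Finset.prod_mul_distrib, Nat.cast_prod]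
    refine Finset.prod_congr rfl fun i hi => ?_
    rw [Nat.cast_sub (by have := Finset.mem_range.1 hi; omega)]
    field_simp
  change -(u n - 1) * (u n)⁻¹ = _
  rw [hdesc, div_mul_cancel_left₀ (pow_ne_zero _ hn0), neg_sub, sub_mul,
    mul_inv_cancel₀ hun, one_mul]

/-! ### Existence of leading coefficients, and the rate of convergence for H_n^d -/

namespace FinRootedTree

theorem IsDAry.two_le_numLeaves {d r : ℕ} {D : Fin r → FinRootedTree} (h : (node r D).IsDAry d) :
    2 ≤ (node r D).numLeaves := by
  simp only [IsDAry] at h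
  rw [numLeaves_node]
  calc 2 ≤ ∑ _j : Fin r, 1 := by simpa using h.1
    _ ≤ _ := Finset.sum_le_sum fun j _ => (h.2.2 j).numLeaves_pos

theorem IsDAry.eq_leaf_of_numLeaves_eq_one {d : ℕ} :
    ∀ {T : FinRootedTree}, T.IsDAry d → T.numLeaves = 1 → T = leaf
  | leaf, _, _ => rfl
  | node r D, h, h1 => by have := h.two_le_numLeaves; omega

theorem hasLeadingCoeff_node_of_numLeaves_eq_two {d r : ℕ} (hd : 2 ≤ d)
    {D : Fin r → FinRootedTree} (hD : (node r D).IsDAry d) {α : Fin r → ℝ}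
    (h : ∀ j, HasLeadingCoeff d (D j) (α j)) (hm : (node r D).numLeaves = 2) {a : ℝ}
    (ha : a * (((d : ℝ) ^ 2 - d) * branchSymm D) = Fintype.card (Fin r ↪ Fin d) * ∏ j, α j) :
    HasLeadingCoeff d (node r D) a := by
  have hD' := hD
  simp only [IsDAry] at hD'
  obtain ⟨hr, -, hDj⟩ := hD'
  have hsum := hm
  rw [numLeaves_node] at hsum
  have hr2 : r = 2 := by
    refine le_antisymm ?_ hr
    calc r = ∑ _j : Fin r, 1 := by simp
      _ ≤ _ := Finset.sum_le_sum fun j _ => (hDj j).numLeaves_pos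
      _ = 2 := hsum
  subst hr2
  have hleaf : ∀ j, D j = leaf := by
    have h0 := (hDj 0).numLeaves_pos
    have h1 := (hDj 1).numLeaves_pos
    rw [Fin.sum_univ_two] at hsum
    intro j
    refine (hDj j).eq_leaf_of_numLeaves_eq_one ?_
    fin_cases j
    · change (D 0).numLeaves = 1; omega
    · change (D 1).numLeaves = 1; omega
  -- The `α j` are known only through `HasLeadingCoeff`; uniqueness of limits pins them down.
  have hα : ∀ j, α j = 1 := fun j => by
    have hj := h j
    rw [hleaf j] at hj
    exact tendsto_nhds_unique (hj.tendsto hd) ((hasLeadingCoeff_leaf hd).tendsto hd)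
  have hcard : (Fintype.card (Fin 2 ↪ Fin d) : ℝ) = (d : ℝ) ^ 2 - d := by
    rw [Fintype.card_embedding_eq, Fintype.card_fin, Fintype.card_fin, Nat.cast_descFactorial_two]
    ring
  have hd' : (2 : ℝ) ≤ d := by exact_mod_cast hd
  have hpos : (0 : ℝ) < (d : ℝ) ^ 2 - d := by nlinarith
  have haA : a * branchSymm D = 1 := by
    simp only [hα, Finset.prod_const_one, hcard, mul_one] at ha
    refine mul_left_cancel₀ hpos.ne' ?_
    linarith
  refine (isBigO_refl _ ⊤).const_mul_left (-a) |>.congr_left fun n => ?_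
  have hN := (strictEvenSize_pos hd n).ne'
  have hc : (copies (node 2 D) (strictEven d n) : ℝ) =
      a * (strictEvenSize d n ^ 2 - strictEvenSize d n) := by
    rw [strictEvenSize, ← branchSymm_mul_copies_of_leaves hleaf, ← mul_assoc, haA, one_mul]
  rw [hm, hc]
  field_simp
  ring

/-- The equation for `a` is a fixed-point condition: with all branches of relative size 1/d, the
recursion reads a = d a d^(-m) + B⁻¹ P (∏ α j) d^(-m), where B is `branchSymm D` and P the number of
embeddings. Hence the main terms cancel, and the deviation from a N^m satisfies the recursion up to
O(N^(m-1)). -/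
theorem hasLeadingCoeff_node {d r : ℕ} (hd : 2 ≤ d) {D : Fin r → FinRootedTree}
    (hD : (node r D).IsDAry d) {α : Fin r → ℝ} (h : ∀ j, HasLeadingCoeff d (D j) (α j)) {a : ℝ}
    (ha : a * (((d : ℝ) ^ (node r D).numLeaves - d) * branchSymm D) =
      Fintype.card (Fin r ↪ Fin d) * ∏ j, α j) :
    HasLeadingCoeff d (node r D) a := by
  have hm := hD.two_le_numLeaves
  by_cases hm2 : (node r D).numLeaves = 2
  · exact hasLeadingCoeff_node_of_numLeaves_eq_two hd hD h hm2 (by rw [← hm2]; exact ha)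
  -- Now m ≥ 3, so the error exponent m - 1 = p + 2 is at least 2.
  obtain ⟨p, hp⟩ : ∃ p, (node r D).numLeaves = p + 3 := ⟨(node r D).numLeaves - 3, by omega⟩
  have hr : 2 ≤ r := by simp only [IsDAry] at hD; exact hD.1
  have hA : (branchSymm D : ℝ) ≠ 0 := by exact_mod_cast (branchSymm_pos D).ne'
  have hd0 : (d : ℝ) ≠ 0 := by exact_mod_cast (show d ≠ 0 by omega)
  set m := (node r D).numLeaves with hmdef
  have hsum : ∑ j, (D j).numLeaves = m := (numLeaves_node r D).symm
  set N : ℕ → ℝ := strictEvenSize d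
  have hN : ∀ n, 0 < N n := strictEvenSize_pos hd
  set E : ℕ → ℝ := fun n => copies (node r D) (strictEven d n) - a * N n ^ m
  have he : (fun n => (N (n + 1))⁻¹) =O[⊤] fun _ => (1 : ℝ) :=
    (isBigO_inv_strictEvenSize_one hd ⊤).comp_tendsto (k := fun n => n + 1) tendsto_top
  have hrec : ∀ n, E (n + 1) - ∑ i, E (branchIndex d n i) =
      (branchSymm D : ℝ)⁻¹ * ∑ σ : Fin r ↪ Fin d,
        ∏ j, (copies (D j) (strictEven d (branchIndex d n (σ j))) : ℝ) +
      a * ∑ i, N (branchIndex d n i) ^ m - a * N (n + 1) ^ m := fun n => by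
    simp only [E]
    rw [strictEven_succ, copies_node_node_real hr, Finset.sum_sub_distrib, ← Finset.mul_sum]
    ring
  have h1 : ∀ σ : Fin r ↪ Fin d, (fun n => ∏ j,
      ((copies (D j) (strictEven d (branchIndex d n (σ j))) : ℝ) / N (n + 1) ^ (D j).numLeaves) -
        ∏ j, (α j * (d : ℝ)⁻¹ ^ (D j).numLeaves)) =O[⊤] fun n => (N (n + 1))⁻¹ := fun σ =>
    isBigO_prod_sub_prod he _ fun j _ => isBigO_copies_branch hd (h j) (σ j)
  have h2 := (IsBigO.sum (s := Finset.univ) fun σ _ => h1 σ).const_mul_left (branchSymm D : ℝ)⁻¹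
  have h3 := (IsBigO.sum (s := Finset.univ) fun i _ =>
    isBigO_pow_sub_pow he (isBigO_strictEvenSize_branch_div hd i) m).const_mul_left a
  have h4 : (fun n => (E (n + 1) - ∑ i, E (branchIndex d n i)) / N (n + 1) ^ m) =O[⊤]
      fun n => (N (n + 1))⁻¹ := by
    refine (h2.add h3).congr_left fun n => ?_
    rw [hrec]
    have hN1 : N (n + 1) ^ m ≠ 0 := pow_ne_zero _ (hN _).ne'
    have hprod : ∀ σ : Fin r ↪ Fin d, ∏ j,
        ((copies (D j) (strictEven d (branchIndex d n (σ j))) : ℝ) / N (n + 1) ^ (D j).numLeaves) =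
        (∏ j, (copies (D j) (strictEven d (branchIndex d n (σ j))) : ℝ)) / N (n + 1) ^ m :=
      fun σ => by rw [Finset.prod_div_distrib, Finset.prod_pow_eq_pow_sum, hsum]
    have hprod' : ∏ j, (α j * (d : ℝ)⁻¹ ^ (D j).numLeaves) = (∏ j, α j) * (d : ℝ)⁻¹ ^ m := by
      rw [Finset.prod_mul_distrib, Finset.prod_pow_eq_pow_sum, hsum]
    have hconst : (branchSymm D : ℝ)⁻¹ *
        (Fintype.card (Fin r ↪ Fin d) * ((∏ j, α j) * (d : ℝ)⁻¹ ^ m)) + a * (d * (d : ℝ)⁻¹ ^ m) =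
        a := by
      rw [← mul_assoc (Fintype.card (Fin r ↪ Fin d) : ℝ), ← ha, inv_pow]
      field_simp
      ring
    simp only [Finset.sum_apply, Finset.sum_sub_distrib, hprod, hprod', Finset.sum_const, Finset.card_univ,
      nsmul_eq_mul, Fintype.card_fin, div_pow]
    rw [← Finset.sum_div, ← Finset.sum_div]
    have hsplit : ∀ X Y : ℝ, (X + a * Y - a * N (n + 1) ^ m) / N (n + 1) ^ m =
        X / N (n + 1) ^ m + a * (Y / N (n + 1) ^ m) - a := fun X Y => by field_simp
    rw [hsplit]
    linear_combination -hconst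
  obtain ⟨C, hC⟩ := isBigO_top.1 h4
  have h5 : ∀ n, |E (n + 1) - ∑ i, E (branchIndex d n i)| ≤ C * N (n + 1) ^ (p + 2) := fun n => by
    have := hC n
    rw [norm_div, norm_inv, Real.norm_of_nonneg (hN _).le, Real.norm_eq_abs,
      Real.norm_of_nonneg (pow_nonneg (hN _).le _), div_le_iff₀ (pow_pos (hN _) _), hp] at this
    refine this.trans_eq ?_
    rw [pow_succ _ (p + 2), mul_assoc, mul_comm _ (N (n + 1)), inv_mul_cancel_left₀ (hN _).ne']
  obtain ⟨C', hC'⟩ := exists_bound_of_recursion hd h5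
  refine isBigO_top.2 ⟨C', fun n => ?_⟩
  have hE : (copies (node r D) (strictEven d n) : ℝ) / N n ^ m - a = E n / N n ^ m := by
    have := pow_ne_zero m (hN n).ne'
    simp only [E]
    field_simp
  rw [hE, norm_div, norm_inv, Real.norm_of_nonneg (hN _).le, Real.norm_eq_abs,
    Real.norm_of_nonneg (pow_nonneg (hN _).le _), div_le_iff₀ (pow_pos (hN _) _), hp]
  refine (hC' n).trans_eq ?_
  rw [pow_succ _ (p + 2), mul_assoc, mul_comm _ (N n), inv_mul_cancel_left₀ (hN _).ne']

/-- The leading coefficient for a tree in terms of those of its branches. -/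
noncomputable def nodeCoeff (d : ℕ) {r : ℕ} (D : Fin r → FinRootedTree) (α : Fin r → ℝ) : ℝ :=
  Fintype.card (Fin r ↪ Fin d) * (∏ j, α j) /
    (((d : ℝ) ^ (node r D).numLeaves - d) * branchSymm D)

theorem pow_sub_self_pos {d m : ℕ} (hd : 2 ≤ d) (hm : 2 ≤ m) : (0 : ℝ) < (d : ℝ) ^ m - d := by
  have hd' : (1 : ℝ) < d := by exact_mod_cast (show 1 < d by omega)
  exact sub_pos.2 (lt_self_pow₀ hd' (by omega))

theorem nodeCoeff_mul {d r : ℕ} (hd : 2 ≤ d) {D : Fin r → FinRootedTree}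
    (hD : (node r D).IsDAry d) (α : Fin r → ℝ) :
    nodeCoeff d D α * (((d : ℝ) ^ (node r D).numLeaves - d) * branchSymm D) =
      Fintype.card (Fin r ↪ Fin d) * ∏ j, α j := by
  have hA : (0 : ℝ) < branchSymm D := by exact_mod_cast branchSymm_pos D
  exact div_mul_cancel₀ _ (mul_pos (pow_sub_self_pos hd hD.two_le_numLeaves) hA).ne'

theorem nodeCoeff_nonneg {d r : ℕ} (hd : 2 ≤ d) {D : Fin r → FinRootedTree}
    (hD : (node r D).IsDAry d) {α : Fin r → ℝ} (hα : ∀ j, 0 ≤ α j) : 0 ≤ nodeCoeff d D α := by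
  have := pow_sub_self_pos hd hD.two_le_numLeaves
  have := Finset.prod_nonneg fun j (_ : j ∈ Finset.univ) => hα j
  unfold nodeCoeff
  positivity

theorem exists_hasLeadingCoeff {d : ℕ} (hd : 2 ≤ d) :
    ∀ {D : FinRootedTree}, D.IsDAry d → ∃ a, HasLeadingCoeff d D a
  | leaf, _ => ⟨1, hasLeadingCoeff_leaf hd⟩
  | node r D, hD => by
    have h : ∀ j, (D j).IsDAry d := by simp only [IsDAry] at hD; exact hD.2.2
    choose α hα using fun j => exists_hasLeadingCoeff hd (h j)
    exact ⟨nodeCoeff d D α, hasLeadingCoeff_node hd hD hα (nodeCoeff_mul hd hD α)⟩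

theorem isBigO_inv_strictEvenSize {d : ℕ} (hd : 2 ≤ d) :
    (fun n => (strictEvenSize d n)⁻¹) =O[atTop] fun n : ℕ => (n : ℝ)⁻¹ := by
  refine IsBigO.of_bound 1 ?_
  filter_upwards [eventually_gt_atTop 0] with n hn
  have hn' : (0 : ℝ) < n := by exact_mod_cast hn
  rw [one_mul, norm_inv, norm_inv, Real.norm_of_nonneg (strictEvenSize_pos hd n).le,
    Real.norm_of_nonneg hn'.le]
  exact inv_anti₀ hn' (le_strictEvenSize hd n)

theorem tendsto_numLeaves_strictEven {d : ℕ} (hd : 2 ≤ d) :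
    Tendsto (fun n => (strictEven d n).numLeaves) atTop atTop :=
  tendsto_natCast_atTop_iff.1 (tendsto_strictEvenSize hd)

theorem isBigO_strictEven_pow_div_choose {d : ℕ} (hd : 2 ≤ d) (m : ℕ) :
    (fun n => strictEvenSize d n ^ m / (m.factorial * (strictEven d n).numLeaves.choose m) - 1)
      =O[atTop] fun n : ℕ => (n : ℝ)⁻¹ :=
  ((isBigO_pow_div_choose_sub_one m).comp_tendsto (tendsto_numLeaves_strictEven hd)).trans
    (isBigO_inv_strictEvenSize hd)

/-- `γ(D, H_n^d)` converges with rate `O(1 / n)`. -/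
theorem HasLeadingCoeff.isBigO_density {d : ℕ} (hd : 2 ≤ d) {D : FinRootedTree} {a : ℝ}
    (h : HasLeadingCoeff d D a) :
    (fun n => density D (strictEven d n) - a * D.numLeaves.factorial) =O[atTop]
      fun n : ℕ => (n : ℝ)⁻¹ := by
  have he : (fun n : ℕ => (n : ℝ)⁻¹) =O[atTop] fun _ => (1 : ℝ) :=
    tendsto_inv_atTop_nhds_zero_nat.isBigO_one ℝ
  have h1 := ((h.mono le_top : _ =O[atTop] _).trans (isBigO_inv_strictEvenSize hd))
  have h2 := (isBigO_mul_sub_mul he h1 (isBigO_strictEven_pow_div_choose hd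
    D.numLeaves)).const_mul_left (D.numLeaves.factorial : ℝ)
  refine h2.congr_left fun n => ?_
  have hN := pow_ne_zero D.numLeaves (strictEvenSize_pos hd n).ne'
  have hf : (D.numLeaves.factorial : ℝ) ≠ 0 := by exact_mod_cast (Nat.factorial_pos _).ne'
  rw [density, mul_sub, div_mul_div_cancel₀ hN, ← mul_div_assoc, mul_div_mul_left _ _ hf]
  ring

theorem HasLeadingCoeff.tendsto_density {d : ℕ} (hd : 2 ≤ d) {D : FinRootedTree} {a : ℝ}
    (h : HasLeadingCoeff d D a) :
    Tendsto (fun n => density D (strictEven d n)) atTop (nhds (a * D.numLeaves.factorial)) := by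
  have := ((h.isBigO_density hd).trans_tendsto tendsto_inv_atTop_nhds_zero_nat).add_const
    (a * D.numLeaves.factorial : ℝ)
  simpa using this

theorem HasLeadingCoeff.eta_eq {d : ℕ} (hd : 2 ≤ d) {D : FinRootedTree} {a : ℝ}
    (h : HasLeadingCoeff d D a) : eta d D = a * D.numLeaves.factorial :=
  (h.tendsto_density hd).limUnder_eq

/-! ### Comparison with the inducibility, and the squeeze -/

theorem density_le_of_copies_le {D T : FinRootedTree} {a : ℝ}
    (h : (copies D T : ℝ) ≤ a * (T.numLeaves : ℝ) ^ D.numLeaves) :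
    density D T ≤ a * D.numLeaves.factorial * ((T.numLeaves : ℝ) ^ D.numLeaves /
      (D.numLeaves.factorial * T.numLeaves.choose D.numLeaves)) := by
  have hf : (D.numLeaves.factorial : ℝ) ≠ 0 := by exact_mod_cast (Nat.factorial_pos _).ne'
  rw [density, mul_div_assoc', mul_assoc a, mul_left_comm a, mul_div_mul_left _ _ hf]
  gcongr

/-- The blow-up bound read as an upper bound for each individual tree. If `T` has fewer leaves than
`D`, both sides are zero, being quotients by zero. -/
theorem density_le_inducibility_mul {d : ℕ} (hd : 2 ≤ d) {D : FinRootedTree} (hD : D.IsDAry d)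
    {T : FinRootedTree} (hT : T.IsDAry d) :
    density D T ≤ inducibility d D * ((T.numLeaves : ℝ) ^ D.numLeaves /
      (D.numLeaves.factorial * T.numLeaves.choose D.numLeaves)) := by
  have hf : (0 : ℝ) < D.numLeaves.factorial := by exact_mod_cast Nat.factorial_pos _
  have hT' : (0 : ℝ) < (T.numLeaves : ℝ) ^ D.numLeaves :=
    pow_pos (by exact_mod_cast hT.numLeaves_pos) _
  have h := copies_mul_factorial_div_pow_le_inducibility hd hD hT
  have := density_le_of_copies_le (D := D) (T := T)
    (a := inducibility d D / D.numLeaves.factorial) (by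
      rw [div_le_iff₀ hT'] at h
      rw [div_mul_eq_mul_div, le_div_iff₀ hf]
      exact h)
  rwa [div_mul_cancel₀ _ hf.ne'] at this

theorem HasLeadingCoeff.le_inducibility {d : ℕ} (hd : 2 ≤ d) {D : FinRootedTree}
    (hD : D.IsDAry d) {a : ℝ} (h : HasLeadingCoeff d D a) :
    a * D.numLeaves.factorial ≤ inducibility d D := by
  refine le_of_tendsto' ((h.tendsto hd).mul_const _) fun n => ?_
  rw [div_mul_eq_mul_div]
  exact copies_mul_factorial_div_pow_le_inducibility hd hD
    ((isStrictlyDAry_strictEven d n).isDAry hd)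

theorem inducibility_le_of_copies_le {d : ℕ} {D : FinRootedTree} {a : ℝ} (ha : 0 ≤ a)
    (h : ∀ T : FinRootedTree, T.IsDAry d →
      (copies D T : ℝ) ≤ a * (T.numLeaves : ℝ) ^ D.numLeaves) :
    inducibility d D ≤ a * D.numLeaves.factorial := by
  have hlim : Tendsto (fun n : ℕ => a * D.numLeaves.factorial *
      ((n : ℝ) ^ D.numLeaves / (D.numLeaves.factorial * n.choose D.numLeaves))) atTop
      (nhds (a * D.numLeaves.factorial)) := by
    have := ((isBigO_pow_div_choose_sub_one D.numLeaves).trans_tendsto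
      tendsto_inv_atTop_nhds_zero_nat).add_const 1
    have := this.const_mul (a * D.numLeaves.factorial : ℝ)
    simpa using this
  refine (limsup_le_limsup (Eventually.of_forall fun n => ?_)
    (isCoboundedUnder_maxDensity d D) hlim.isBoundedUnder_le).trans_eq hlim.limsup_eq
  refine Real.sSup_le ?_ (by positivity)
  rintro x ⟨T, hT, rfl, rfl⟩
  exact density_le_of_copies_le (h T hT)

/-- Only finitely many densities are possible: the denominator is fixed and bounds the numerator. So
the supremum is attained without enumerating trees. -/
theorem isGreatest_maxStrictDensity {d : ℕ} (hd : 2 ≤ d) (D : FinRootedTree) (n : ℕ) :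
    IsGreatest (strictDensities d D n) (maxStrictDensity d D n) := by
  have hne : (strictDensities d D n).Nonempty :=
    ⟨_, strictEven d n, isStrictlyDAry_strictEven d n, numLeaves_strictEven hd n, rfl⟩
  have hfin : (strictDensities d D n).Finite := by
    refine ((Finset.range (((d - 1) * n + 1).choose D.numLeaves + 1)).finite_toSet.image
      fun c : ℕ => (c : ℝ) / (((d - 1) * n + 1).choose D.numLeaves : ℝ)).subset ?_
    rintro x ⟨T, -, hT, rfl⟩
    refine ⟨copies D T, ?_, by rw [density, hT]⟩
    have := copies_le_choose D T
    rw [hT] at this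
    simpa using Nat.lt_succ_of_le this
  exact ⟨hne.csSup_mem hfin, fun x hx => le_csSup hfin.bddAbove hx⟩

theorem isBigO_maxStrictDensity_sub {d : ℕ} (hd : 2 ≤ d) {D : FinRootedTree} (hD : D.IsDAry d)
    (h : inducibility d D = eta d D) :
    (fun n => maxStrictDensity d D n - inducibility d D) =O[atTop] fun n : ℕ => (n : ℝ)⁻¹ := by
  obtain ⟨a, ha⟩ := exists_hasLeadingCoeff hd hD
  have h1 := ha.isBigO_density hd
  rw [← ha.eta_eq hd, ← h] at h1
  have h2 := (isBigO_strictEven_pow_div_choose hd D.numLeaves).const_mul_left (inducibility d D)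
  -- The maximum lies between the density in H_n^d and the blow-up bound, so its distance from the
  -- inducibility is at most the sum of their two errors.
  refine IsBigO.trans (IsBigO.of_bound 1 (Eventually.of_forall fun n => ?_))
    (h1.norm_left.add h2.norm_left)
  have hgr := isGreatest_maxStrictDensity hd D n
  have hlow : density D (strictEven d n) ≤ maxStrictDensity d D n :=
    hgr.2 ⟨_, isStrictlyDAry_strictEven d n, numLeaves_strictEven hd n, rfl⟩
  have hup : maxStrictDensity d D n ≤ inducibility d D * (strictEvenSize d n ^ D.numLeaves /
      (D.numLeaves.factorial * (strictEven d n).numLeaves.choose D.numLeaves)) := by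
    obtain ⟨T, hT, hTn, hx⟩ := hgr.1
    rw [hx, strictEvenSize, numLeaves_strictEven hd, ← hTn]
    exact density_le_inducibility_mul hd hD (hT.isDAry hd)
  rw [one_mul, Real.norm_of_nonneg (add_nonneg (norm_nonneg _) (norm_nonneg _)), Real.norm_eq_abs,
    Real.norm_eq_abs, Real.norm_eq_abs, abs_le]
  constructor
  · have := neg_abs_le (density D (strictEven d n) - inducibility d D)
    linarith [abs_nonneg (inducibility d D * (strictEvenSize d n ^ D.numLeaves /
      (D.numLeaves.factorial * (strictEven d n).numLeaves.choose D.numLeaves) - 1))]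
  · have := le_abs_self (inducibility d D * (strictEvenSize d n ^ D.numLeaves /
      (D.numLeaves.factorial * (strictEven d n).numLeaves.choose D.numLeaves) - 1))
    linarith [abs_nonneg (density D (strictEven d n) - inducibility d D)]

/-! ### Optimality of even trees -/

/-- Upper bounds for the branches of a balanced tree give the optimal upper bound for the tree. -/
theorem copies_node_le {d r : ℕ} (hd : 2 ≤ d) {D : Fin r → FinRootedTree}
    (hD : (node r D).IsDAry d) (hbal : IsBalanced d fun j => (D j).numLeaves) {α : Fin r → ℝ}
    (hα : ∀ j, 0 ≤ α j)
    (h : ∀ j, ∀ T : FinRootedTree, T.IsDAry d →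
      (copies (D j) T : ℝ) ≤ α j * (T.numLeaves : ℝ) ^ (D j).numLeaves) :
    ∀ T : FinRootedTree, T.IsDAry d →
      (copies (node r D) T : ℝ) ≤ nodeCoeff d D α * (T.numLeaves : ℝ) ^ (node r D).numLeaves
  | leaf, _ => by
    rw [copies_node_leaf]
    simpa using nodeCoeff_nonneg hd hD hα
  | node l c, hT => by
    have hT' := hT
    simp only [IsDAry] at hT'
    have hr : 2 ≤ r := by simp only [IsDAry] at hD; exact hD.1
    have hm := hD.two_le_numLeaves
    have hA : (0 : ℝ) < branchSymm D := by exact_mod_cast branchSymm_pos D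
    have hdm := pow_sub_self_pos hd hm
    have hP : 0 ≤ ∏ j, α j := Finset.prod_nonneg fun j _ => hα j
    have hmuir := mul_sum_embedding_le_of_le hT'.2.1 (x := fun i => ((c i).numLeaves : ℝ))
      (fun i => Nat.cast_nonneg _) hbal (by omega) (by omega) (numLeaves_node r D).symm
    have hsum : ∑ σ : Fin r ↪ Fin l, ∏ j, (copies (D j) (c (σ j)) : ℝ) ≤
        (∏ j, α j) * ∑ σ : Fin r ↪ Fin l, ∏ j, ((c (σ j)).numLeaves : ℝ) ^ (D j).numLeaves := by
      rw [Finset.mul_sum]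
      refine Finset.sum_le_sum fun σ _ => ?_
      rw [← Finset.prod_mul_distrib]
      exact Finset.prod_le_prod (fun j _ => Nat.cast_nonneg _)
        fun j _ => h j _ (hT'.2.2 (σ j))
    have hbranch : ∑ i, (copies (node r D) (c i) : ℝ) ≤
        nodeCoeff d D α * ∑ i, ((c i).numLeaves : ℝ) ^ (node r D).numLeaves := by
      rw [Finset.mul_sum]
      exact Finset.sum_le_sum fun i _ => copies_node_le hd hD hbal hα h (c i) (hT'.2.2 i)
    have hcoeff := nodeCoeff_mul hd hD α
    have hN : ((node l c).numLeaves : ℝ) = ∑ i, ((c i).numLeaves : ℝ) := by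
      rw [numLeaves_node]; push_cast; rfl
    rw [copies_node_node_real hr, hN]
    set m := (node r D).numLeaves
    set Q := ∑ σ : Fin r ↪ Fin l, ∏ j, ((c (σ j)).numLeaves : ℝ) ^ (D j).numLeaves
    set R := (∑ i, ((c i).numLeaves : ℝ)) ^ m
    set R' := ∑ i, ((c i).numLeaves : ℝ) ^ m
    -- Copies spread over several branches cost at most `R - R'` times the coefficient, copies
    -- inside one branch at most `R'` times it by induction; together this is the claimed `R`.
    have key : (branchSymm D : ℝ)⁻¹ * ((∏ j, α j) * Q) ≤ nodeCoeff d D α * (R - R') := by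
      rw [inv_mul_le_iff₀ hA]
      refine le_of_mul_le_mul_left ?_ hdm
      calc ((d : ℝ) ^ m - d) * ((∏ j, α j) * Q) = (∏ j, α j) * (((d : ℝ) ^ m - d) * Q) := by ring
        _ ≤ (∏ j, α j) * (Fintype.card (Fin r ↪ Fin d) * (R - R')) :=
          mul_le_mul_of_nonneg_left hmuir hP
        _ = (Fintype.card (Fin r ↪ Fin d) * ∏ j, α j) * (R - R') := by ring
        _ = _ := by rw [← hcoeff]; ring
    have := mul_le_mul_of_nonneg_left hsum (inv_pos.2 hA).le
    linarith

/-- The density of `D` is asymptotically largest in the trees `H_n^d`, in the strong sense that the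
leading term for `H_n^d` is an upper bound for all `d`-ary trees. -/
def IsOptimallyEven (d : ℕ) (D : FinRootedTree) : Prop :=
  ∃ a, 0 ≤ a ∧ HasLeadingCoeff d D a ∧ ∀ T : FinRootedTree, T.IsDAry d →
    (copies D T : ℝ) ≤ a * (T.numLeaves : ℝ) ^ D.numLeaves

theorem isOptimallyEven_leaf {d : ℕ} (hd : 2 ≤ d) : IsOptimallyEven d leaf :=
  ⟨1, zero_le_one, hasLeadingCoeff_leaf hd, fun T _ => by simp [copies_leaf]⟩

/-- The asymptotics in H_n^d and the universal upper bound propagate through the same constant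
`nodeCoeff`, so optimality passes from the branches to the tree. -/
theorem isOptimallyEven_node {d r : ℕ} (hd : 2 ≤ d) {D : Fin r → FinRootedTree}
    (hD : (node r D).IsDAry d) (hbal : IsBalanced d fun j => (D j).numLeaves)
    (h : ∀ j, IsOptimallyEven d (D j)) : IsOptimallyEven d (node r D) := by
  choose α hα hlead hle using h
  exact ⟨nodeCoeff d D α, nodeCoeff_nonneg hd hD hα,
    hasLeadingCoeff_node hd hD hlead (nodeCoeff_mul hd hD α), copies_node_le hd hD hbal hα hle⟩

theorem IsOptimallyEven.inducibility_eq_eta {d : ℕ} (hd : 2 ≤ d) {D : FinRootedTree}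
    (hD : D.IsDAry d) (h : IsOptimallyEven d D) : inducibility d D = eta d D := by
  obtain ⟨a, ha, hlead, hle⟩ := h
  rw [hlead.eta_eq hd]
  exact le_antisymm (inducibility_le_of_copies_le ha hle) (hlead.le_inducibility hd hD)

theorem even_spec {d : ℕ} (hd : 2 ≤ d) {k : ℕ} (hk : 1 ≤ k) :
    (even d k).IsDAry d ∧ (even d k).numLeaves = k ∧ IsOptimallyEven d (even d k) := by
  induction k using Nat.strong_induction_on with
  | _ k ih =>
    rw [even]
    split_ifs with h1 h2
    · obtain rfl : k = 1 := by omega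
      exact ⟨by simp [IsDAry], rfl, isOptimallyEven_leaf hd⟩
    · have hD : (node k fun _ => leaf).IsDAry d := by
        simp only [IsDAry]
        exact ⟨by omega, h2, fun _ => trivial⟩
      exact ⟨hD, by simp [numLeaves_node], isOptimallyEven_node hd hD
        ⟨fun _ _ => by simp, Or.inr fun _ => le_rfl⟩ fun _ => isOptimallyEven_leaf hd⟩
    · have hs : 1 ≤ k / d := (Nat.one_le_div_iff (by omega)).2 (by omega)
      have hs' : k / d ≤ k / 2 := Nat.div_le_div_left hd (by omega)
      -- The sizes of the branches of E_k^d are the indices of the branches of H_{k+1}^d: here `k`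
      -- itself is split into `d` nearly equal parts.
      have hb : ∀ i : Fin d, 1 ≤ branchIndex d k i ∧ branchIndex d k i < k ∧
          k / d ≤ branchIndex d k i ∧ branchIndex d k i ≤ k / d + 1 := fun i => by
        unfold branchIndex
        split_ifs <;> omega
      have hfun : (fun i : Fin d => if (i : ℕ) < d - k % d then even d (k / d)
          else even d (k / d + 1)) = fun i => even d (branchIndex d k i) := by
        funext i
        unfold branchIndex
        split_ifs <;> rfl
      rw [hfun]
      have hih : ∀ i, _ := fun i => ih (branchIndex d k i) (hb i).2.1 (hb i).1
      have hD : (node d fun i => even d (branchIndex d k i)).IsDAry d := by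
        simp only [IsDAry]
        exact ⟨hd, le_rfl, fun i => (hih i).1⟩
      refine ⟨hD, ?_, isOptimallyEven_node hd hD ⟨fun i j => ?_, Or.inl rfl⟩ fun i => (hih i).2.2⟩
      · rw [numLeaves_node, Finset.sum_congr rfl fun i _ => (hih i).2.1,
          sum_branchIndex (by omega)]
      · have hi := hb i
        have hj := hb j
        simp only [(hih _).2.1]
        omega

end FinRootedTree

theorem theorem7 (d : ℕ) (hd : 2 ≤ d) :
    (∀ D : FinRootedTree, D.IsDAry d →
      -- the limit that defines `η_d(D)` exists, and so do the maxima
      Filter.Tendsto (fun n : ℕ => FinRootedTree.density D (FinRootedTree.strictEven d n)) Filter.atTop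
        (nhds (FinRootedTree.eta d D)) ∧
      (∀ n : ℕ, IsGreatest (FinRootedTree.strictDensities d D n)
        (FinRootedTree.maxStrictDensity d D n)) ∧
      -- the rate of convergence
      (FinRootedTree.inducibility d D = FinRootedTree.eta d D →
        (fun n : ℕ => FinRootedTree.maxStrictDensity d D n - FinRootedTree.inducibility d D)
          =O[Filter.atTop] (fun n : ℕ => (n : ℝ)⁻¹))) ∧
    -- all even trees satisfy the hypothesis
    (∀ k : ℕ, 1 ≤ k →
      (FinRootedTree.even d k).IsDAry d ∧ (FinRootedTree.even d k).numLeaves = k ∧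
      FinRootedTree.inducibility d (FinRootedTree.even d k) =
        FinRootedTree.eta d (FinRootedTree.even d k)) := by
  refine ⟨fun D hD => ⟨?_, FinRootedTree.isGreatest_maxStrictDensity hd D,
    FinRootedTree.isBigO_maxStrictDensity_sub hd hD⟩, fun k hk => ?_⟩
  · obtain ⟨a, ha⟩ := FinRootedTree.exists_hasLeadingCoeff hd hD
    rw [ha.eta_eq hd]
    exact ha.tendsto_density hd
  · obtain ⟨hD, hn, hopt⟩ := FinRootedTree.even_spec hd hk
    exact ⟨hD, hn, hopt.inducibility_eq_eta hd hD⟩
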